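/- For $0<\lambda<1$ and $\theta=\arcsin\sqrt\lambda$, let $P_k^{\phi}(\lambda)=\big|\big(G^k(\sin\theta,\cos\theta)^{T}\big)_1\big|^2$ be the success probability of amplitude amplification after $k$ iterations with phase $\phi$, when $\lambda$ is the fraction of target items, where $$G=\begin{pmatrix}-e^{i\phi}(e^{i\phi}\sin^2\theta+\cos^2\theta)&(1-e^{i\phi})\sin\theta\cos\theta\\ e^{i\phi}(1-e^{i\phi})\sin\theta\cos\theta&-e^{i\phi}\cos^2\theta-\sin^2\theta\end{pmatrix}.$$ Fix integers $k\ge1$ and $n\ge1$, and put $\Lambda_k=\big[\sin^2\frac{\pi}{4k+2},\,\sin^2\frac{\pi}{4k-2}\big)$ and $$\phi_k^{\min}=\arccos\Big(1-\frac{2-2\cos\frac{\pi}{2k+1}}{1-\cos\frac{\pi}{2k-1}}\Big).$$ Call $(\phi_1,\dots,\phi_n)$ admissible if $\pi\ge\phi_1>\phi_2>\dots>\phi_n>\phi_k^{\min}$. Call an admissible tuple optimal if, among all admissible tuples of length $n$, it maximises the minimum success probability on $\Lambda_k$, that is, the quantity $$\sup_{s}\ \inf_{\lambda\in\Lambda_k}P_k^{\phi_{s(\lambda)}}(\lambda),$$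 where $s:\Lambda_k\to\{1,\dots,n\}$ ranges over all subdivisions of $\Lambda_k$ into $n$ parts (the phase $\phi_m$ being used on the part $s^{-1}(m)$). Theorem. Let $(\phi_1,\dots,\phi_n)$ be admissible. For $1\le m\le n-1$ the curves $P_k^{\phi_m}$ and $P_k^{\phi_{m+1}}$ intersect in exactly one point $a_m$ of $\Lambda_k$. Put $a_0=\sin^2\frac{\pi}{4k+2}$, and let $$\lambda_{\mathrm{key}}=\begin{cases}\dfrac{5-4\cos\phi_n}{6-6\cos\phi_n},&k=1,\\[2mm]\sin^2\dfrac{\pi}{4k-2},&k\ge2.\end{cases}$$ Then $(\phi_1,\dots,\phi_n)$ is optimal if and only if $$P_k^{\phi_1}(a_0)=P_k^{\phi_2}(a_1)=\dots=P_k^{\phi_m}(a_{m-1})=\dots=P_k^{\phi_n}(a_{n-1})=P_k^{\phi_n}(\lambda_{\mathrm{key}}).$$ -/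

import Mathlib

noncomputable section

namespace MultiphaseSearch

/-- Matrix of the Grover iteration `G(φ, φ) = -H S₀^φ H S_f^φ` with matched phases, in the orthonormal
basis (target state `|α⟩`, non-target state `|β⟩`), where `sin² θ` is the fraction of target items. -/
def groverMatrix (φ θ : ℝ) : Matrix (Fin 2) (Fin 2) ℂ :=
  let e : ℂ := Complex.exp (Complex.I * φ)
  let s : ℂ := (Real.sin θ : ℂ)
  let c : ℂ := (Real.cos θ : ℂ)
  !![-e * (e * s ^ 2 + c ^ 2), (1 - e) * s * c;
     e * (1 - e) * s * c, -e * c ^ 2 - s ^ 2]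

/-- The initial state `sin θ |α⟩ + cos θ |β⟩`. -/
def initialState (θ : ℝ) : Fin 2 → ℂ := ![(Real.sin θ : ℂ), (Real.cos θ : ℂ)]

/-- `P_k^φ(lam)`: the probability of measuring a target item after `k` iterations with phase `φ`,
when the fraction of target items is `lam`. -/
def successProb (k : ℕ) (φ lam : ℝ) : ℝ :=
  let θ := Real.arcsin (Real.sqrt lam)
  Complex.normSq (((groverMatrix φ θ) ^ k).mulVec (initialState θ) 0)

/-- `sin²(π / (4k + 2))`, which is `1` for `k = 0`. -/
def piMax (k : ℕ) : ℝ := Real.sin (Real.pi / (4 * (k : ℝ) + 2)) ^ 2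

/-- The range `Λ_k = [sin²(π/(4k+2)), sin²(π/(4k-2)))`, for `k ≥ 1`. -/
def range (k : ℕ) : Set ℝ := Set.Ico (piMax k) (piMax (k - 1))

/-- The lower end `φ_k^min` of the phases used on `Λ_k`. -/
def phaseMin (k : ℕ) : ℝ :=
  Real.arccos (1 - (2 - 2 * Real.cos (Real.pi / (2 * (k : ℝ) + 1))) /
    (1 - Real.cos (Real.pi / (2 * (k : ℝ) - 1))))

/-- `φ 1 > φ 2 > ⋯ > φ n` are phases in `(φ_k^min, π]`. Other indices are irrelevant. -/
def AdmissiblePhases (k n : ℕ) (φ : ℕ → ℝ) : Prop :=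
  (∀ m ∈ Set.Icc 1 n, φ m ∈ Set.Ioc (phaseMin k) Real.pi) ∧ StrictAntiOn φ (Set.Icc 1 n)

/-- A subdivision of `Λ_k` into `n` parts: the point `lam` lies in the part with number `s lam`. -/
def Subdivision (k n : ℕ) : Type := {s : range k → ℕ // ∀ lam, s lam ∈ Set.Icc 1 n}

/-- Minimum (infimum) over `Λ_k` of the success probability of the algorithm that runs `k`
iterations with phase `φ m` on the `m`-th part of the given subdivision. -/
def minSuccessOn (k n : ℕ) (φ : ℕ → ℝ) (s : Subdivision k n) : ℝ :=
  ⨅ lam : range k, successProb k (φ (s.1 lam)) lam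

/-- The minimum success probability on `Λ_k` with the phases `φ 1, …, φ n`, each phase being used
on its part of the best subdivision. -/
def minSuccess (k n : ℕ) (φ : ℕ → ℝ) : ℝ := ⨆ s : Subdivision k n, minSuccessOn k n φ s

/-- The phases `φ 1 > ⋯ > φ n` yield the largest minimum success probability on `Λ_k`. -/
def OptimalPhases (k n : ℕ) (φ : ℕ → ℝ) : Prop :=
  AdmissiblePhases k n φ ∧ ∀ ψ : ℕ → ℝ, AdmissiblePhases k n ψ → minSuccess k n ψ ≤ minSuccess k n φ

/-- `x` is a point of intersection, on `Λ_k`, of the curves with phases `φ` and `ψ`. -/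
def IsCrossing (k : ℕ) (φ ψ x : ℝ) : Prop :=
  x ∈ range k ∧ successProb k φ x = successProb k ψ x

/-- The division points `a_{k,0}, …, a_{k,n}`: the end points of `Λ_k`, and between them the
intersections of consecutive curves. -/
def IsDivision (k n : ℕ) (φ a : ℕ → ℝ) : Prop :=
  a 0 = piMax k ∧ a n = piMax (k - 1) ∧
    ∀ m, 1 ≤ m → m < n → IsCrossing k (φ m) (φ (m + 1)) (a m)

/-- `λ_key`, where `φ` is the smallest phase. -/
def lamKey (k : ℕ) (φ : ℝ) : ℝ :=
  if k = 1 then (5 - 4 * Real.cos φ) / (6 - 6 * Real.cos φ) else piMax (k - 1)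

end MultiphaseSearch

end

/-! With c = sin²(φ/2), the failure probability is (1 - λ) D(cλ)², where D is the polynomial with
cos β · D(sin² β) = cos((2k+1)β) (`successProb_eq`). The iteration satisfies a quadratic equation,
which gives the recursion of D, and it is unitary, so the second component of the state determines
the success probability.

Let p, q be the end points of Λ_k. On [0, q] the function D decreases through its zero p. Admissible
phases correspond to p/q < c ≤ 1, so each failure curve falls to zero at λ = p/c in [p, q), then
rises to its maximum over the remaining range at λ_key, written K c. Left of its zero a curve drops
when c grows; right of it, when c shrinks. `PhaseFamily` collects what is needed; `phaseFamily`
verifies it, with an interior maximum only for k = 1.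

Sufficiency (`le_of_equalized`) is a pigeonhole argument. If all values at a_0, …, a_{n-1} and λ_key
equal e, a curve with failure below e at the j-th of these n + 1 points must have its ratio strictly
between c_{j+1} and c_j (one-sided at the extremes). These intervals are disjoint, so n ratios
cannot serve all the points.

Necessity (`exists_better`) is a perturbation argument. The parameters a_0, c_1, a_1, c_2, …, c_n
form a chain whose links are the failures of neighbours, closed by the value at λ_key. Moving one
parameter trades its two links against each other, so a single link below the maximum V lets all
links be pushed below V. The moved points need not be crossings, which is why `Separates` asks for
less. -/

open Set Filter Topology

namespace MultiphaseSearch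

/-! ### The polynomial behind the failure probability. -/

/-- The polynomial with `cos β * failPoly k (sin² β) = cos ((2k + 1) β)`. -/
def failPoly : ℕ → ℝ → ℝ
  | 0, _ => 1
  | 1, y => 1 - 4 * y
  | k + 2, y => 2 * (1 - 2 * y) * failPoly (k + 1) y - failPoly k y

theorem continuous_failPoly : ∀ k, Continuous (failPoly k)
  | 0 => by simpa only [failPoly] using continuous_const
  | 1 => by simp only [failPoly]; fun_prop
  | k + 2 => by
    have h1 := continuous_failPoly (k + 1)
    have h0 := continuous_failPoly k
    simp only [failPoly]
    fun_prop

theorem cos_mul_failPoly_sin_sq (β : ℝ) :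
    ∀ k : ℕ, Real.cos β * failPoly k (Real.sin β ^ 2) = Real.cos ((2 * k + 1) * β)
  | 0 => by simp [failPoly]
  | 1 => by
    have h := Real.cos_three_mul β
    have e : (2 * ((1 : ℕ) : ℝ) + 1) * β = 3 * β := by push_cast; ring
    rw [e, h, failPoly, Real.sin_sq]
    ring
  | k + 2 => by
    have h1 := cos_mul_failPoly_sin_sq β (k + 1)
    have h0 := cos_mul_failPoly_sin_sq β k
    have e2 : (2 * ((k + 2 : ℕ) : ℝ) + 1) * β = (2 * ((k + 1 : ℕ) : ℝ) + 1) * β + 2 * β := by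
      push_cast; ring
    have e0 : (2 * (k : ℝ) + 1) * β = (2 * ((k + 1 : ℕ) : ℝ) + 1) * β - 2 * β := by
      push_cast; ring
    rw [e0, Real.cos_sub] at h0
    rw [e2, Real.cos_add, failPoly]
    have hc : Real.cos (2 * β) = 1 - 2 * Real.sin β ^ 2 := by
      rw [Real.cos_two_mul, Real.sin_sq]; ring
    rw [hc] at h0 ⊢
    linear_combination 2 * (1 - 2 * Real.sin β ^ 2) * h1 - h0

theorem failPoly_sin_sq (k : ℕ) {β : ℝ} (h : Real.cos β ≠ 0) :
    failPoly k (Real.sin β ^ 2) = Real.cos ((2 * k + 1) * β) / Real.cos β := by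
  rw [eq_div_iff h, mul_comm, cos_mul_failPoly_sin_sq]

/-! ### Closed form of the success probability. -/

/-- `sin² (φ / 2)`. -/
noncomputable def phaseRatio (φ : ℝ) : ℝ := (1 - Real.cos φ) / 2

theorem two_mul_exp_mul_cos (φ : ℝ) : 2 * Complex.exp (Complex.I * φ) * (Real.cos φ : ℂ) =
    Complex.exp (Complex.I * φ) ^ 2 + 1 := by
  rw [Complex.ofReal_cos, Complex.cos, mul_comm Complex.I]
  have : Complex.exp (φ * Complex.I) * Complex.exp (-φ * Complex.I) = 1 := by
    rw [← Complex.exp_add]; simp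
  linear_combination this

/-- This is Cayley–Hamilton, with determinant e² for e = exp(iφ). Up to powers of -e it becomes the
three-term recursion of `failPoly`. -/
theorem groverMatrix_sq (φ θ : ℝ) :
    groverMatrix φ θ ^ 2 =
      (-2 * Complex.exp (Complex.I * φ) * (1 - 2 * (phaseRatio φ * Real.sin θ ^ 2 : ℝ))) •
        groverMatrix φ θ - (Complex.exp (Complex.I * φ) ^ 2) • (1 : Matrix (Fin 2) (Fin 2) ℂ) := by
  have hsc : (Real.sin θ : ℂ) ^ 2 + (Real.cos θ : ℂ) ^ 2 = 1 := by
    exact_mod_cast Real.sin_sq_add_cos_sq θ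
  have he := two_mul_exp_mul_cos φ
  have hr : ((phaseRatio φ * Real.sin θ ^ 2 : ℝ) : ℂ) =
      (1 - (Real.cos φ : ℂ)) / 2 * (Real.sin θ : ℂ) ^ 2 := by
    simp only [phaseRatio]; push_cast; ring
  rw [hr]
  rw [pow_two]
  ext i j
  fin_cases i <;> fin_cases j <;>
    simp only [groverMatrix, Matrix.mul_apply, Fin.sum_univ_two, Matrix.sub_apply,
      Matrix.smul_apply, Matrix.one_apply, Fin.zero_eta, Fin.mk_one, Matrix.of_apply,
      Matrix.cons_val_zero, Matrix.cons_val_one, Matrix.cons_val', Matrix.cons_val_fin_one,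
      smul_eq_mul, Fin.isValue, if_true, one_ne_zero, zero_ne_one, if_false]
  all_goals
    generalize Complex.exp (Complex.I * φ) = e at *
    generalize (Real.sin θ : ℂ) = s at *
    generalize (Real.cos θ : ℂ) = c at *
    generalize (Real.cos φ : ℂ) = x at *
  -- The factor `s ^ 2 * he - 2 * e * hsc` rewrites the trace; the extra term on the diagonal
  -- reduces the determinant e²(s² + c²)² to e².
  · linear_combination (-e * (e * s ^ 2 + c ^ 2)) * (s ^ 2 * he - 2 * e * hsc) -
      e ^ 2 * (s ^ 2 + c ^ 2 + 1) * hsc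
  · linear_combination ((1 - e) * s * c) * (s ^ 2 * he - 2 * e * hsc)
  · linear_combination (e * (1 - e) * s * c) * (s ^ 2 * he - 2 * e * hsc)
  · linear_combination (-e * c ^ 2 - s ^ 2) * (s ^ 2 * he - 2 * e * hsc) -
      e ^ 2 * (s ^ 2 + c ^ 2 + 1) * hsc

theorem mulVec_groverMatrix_pow_one (φ θ : ℝ) : ∀ k : ℕ,
    ((groverMatrix φ θ) ^ k).mulVec (initialState θ) 1 =
      (-Complex.exp (Complex.I * φ)) ^ k * (Real.cos θ : ℂ) *
        (failPoly k (phaseRatio φ * Real.sin θ ^ 2) : ℝ)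
  | 0 => by simp [initialState, failPoly]
  | 1 => by
    have hsc : (Real.sin θ : ℂ) ^ 2 + (Real.cos θ : ℂ) ^ 2 = 1 := by
      exact_mod_cast Real.sin_sq_add_cos_sq θ
    have he := two_mul_exp_mul_cos φ
    simp only [failPoly, phaseRatio, pow_one, groverMatrix, initialState, Matrix.mulVec, dotProduct,
      Fin.sum_univ_two, Fin.isValue, Matrix.of_apply,
      Matrix.cons_val_zero, Matrix.cons_val_one, Matrix.cons_val', Matrix.cons_val_fin_one]
    push_cast
    push_cast at he hsc
    generalize Complex.exp (Complex.I * φ) = e at *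
    generalize Complex.cos φ = x at *
    generalize Complex.sin θ = s at *
    generalize Complex.cos θ = c at *
    linear_combination (-e * c) * hsc + c * s ^ 2 * he
  | k + 2 => by
    have h1 := mulVec_groverMatrix_pow_one φ θ (k + 1)
    have h0 := mulVec_groverMatrix_pow_one φ θ k
    have hG : groverMatrix φ θ ^ (k + 2) =
        (-2 * Complex.exp (Complex.I * φ) * (1 - 2 * (phaseRatio φ * Real.sin θ ^ 2 : ℝ))) •
          groverMatrix φ θ ^ (k + 1) - (Complex.exp (Complex.I * φ) ^ 2) • groverMatrix φ θ ^ k := by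
      rw [pow_add, groverMatrix_sq, mul_sub, mul_smul_comm, mul_smul_comm, mul_one, ← pow_succ]
    rw [hG, Matrix.sub_mulVec, Matrix.smul_mulVec, Matrix.smul_mulVec, Pi.sub_apply, Pi.smul_apply,
      Pi.smul_apply, h1, h0, failPoly]
    simp only [smul_eq_mul]
    push_cast
    ring

/-- Unitarity: it reduces the success probability to the second component, whose modulus is |cos θ ·
D|. -/
theorem normSq_mulVec_groverMatrix (φ θ : ℝ) (v : Fin 2 → ℂ) :
    Complex.normSq ((groverMatrix φ θ).mulVec v 0) + Complex.normSq ((groverMatrix φ θ).mulVec v 1) =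
      Complex.normSq (v 0) + Complex.normSq (v 1) := by
  have hsc : (Real.sin θ : ℂ) ^ 2 + (Real.cos θ : ℂ) ^ 2 = 1 := by
    exact_mod_cast Real.sin_sq_add_cos_sq θ
  have he : (starRingEnd ℂ) (Complex.exp (Complex.I * φ)) * Complex.exp (Complex.I * φ) = 1 := by
    rw [← Complex.normSq_eq_conj_mul_self, Complex.normSq_eq_norm_sq, mul_comm,
      Complex.norm_exp_ofReal_mul_I, one_pow, Complex.ofReal_one]
  have hs := Complex.conj_ofReal (Real.sin θ)
  have hc := Complex.conj_ofReal (Real.cos θ)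
  apply Complex.ofReal_injective
  push_cast [Complex.normSq_eq_conj_mul_self]
  simp only [groverMatrix, Matrix.mulVec, dotProduct,
      Fin.sum_univ_two, Fin.isValue, Matrix.of_apply,
      Matrix.cons_val_zero, Matrix.cons_val_one, Matrix.cons_val', Matrix.cons_val_fin_one,
      map_add, map_mul, map_sub, map_neg, map_one, map_pow, hs, hc]
  generalize Complex.exp (Complex.I * φ) = e at *
  generalize (starRingEnd ℂ) e = e' at *
  generalize (Real.sin θ : ℂ) = s at *
  generalize (Real.cos θ : ℂ) = c at *
  generalize (starRingEnd ℂ) (v 0) = x' at *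
  generalize (starRingEnd ℂ) (v 1) = y' at *
  generalize v 0 = x at *
  generalize v 1 = y at *
  clear hs hc
  grind

theorem normSq_mulVec_groverMatrix_pow (φ θ : ℝ) (v : Fin 2 → ℂ) : ∀ k : ℕ,
    Complex.normSq (((groverMatrix φ θ) ^ k).mulVec v 0) +
      Complex.normSq (((groverMatrix φ θ) ^ k).mulVec v 1) =
      Complex.normSq (v 0) + Complex.normSq (v 1)
  | 0 => by simp
  | k + 1 => by
    rw [pow_succ', ← Matrix.mulVec_mulVec, normSq_mulVec_groverMatrix,
      normSq_mulVec_groverMatrix_pow φ θ v k]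

theorem successProb_eq (k : ℕ) (φ : ℝ) {lam : ℝ} (h : lam ∈ Icc (0 : ℝ) 1) :
    successProb k φ lam = 1 - (1 - lam) * failPoly k (phaseRatio φ * lam) ^ 2 := by
  have hs : Real.sin (Real.arcsin (Real.sqrt lam)) = Real.sqrt lam :=
    Real.sin_arcsin (by linarith [Real.sqrt_nonneg lam]) (Real.sqrt_le_one.2 h.2)
  have hs2 : Real.sin (Real.arcsin (Real.sqrt lam)) ^ 2 = lam := by rw [hs, Real.sq_sqrt h.1]
  have hc2 : Real.cos (Real.arcsin (Real.sqrt lam)) ^ 2 = 1 - lam := by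
    rw [Real.cos_sq', hs2]
  have hn := normSq_mulVec_groverMatrix_pow φ (Real.arcsin (Real.sqrt lam))
    (initialState (Real.arcsin (Real.sqrt lam))) k
  have h1 : Complex.normSq (initialState (Real.arcsin (Real.sqrt lam)) 0) +
      Complex.normSq (initialState (Real.arcsin (Real.sqrt lam)) 1) = 1 := by
    simp only [initialState, Matrix.cons_val_zero, Matrix.cons_val_one, Matrix.cons_val_fin_one,
      Complex.normSq_ofReal, ← pow_two]
    linarith
  rw [h1, mulVec_groverMatrix_pow_one, hs2] at hn
  have he : Complex.normSq (Complex.exp (Complex.I * φ)) = 1 := by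
    rw [Complex.normSq_eq_norm_sq, mul_comm, Complex.norm_exp_ofReal_mul_I, one_pow]
  rw [map_mul, map_mul, map_pow, Complex.normSq_neg, he, one_pow, one_mul, Complex.normSq_ofReal,
    Complex.normSq_ofReal, ← pow_two, ← pow_two, hc2] at hn
  unfold successProb
  linarith

/-! ### Propagating strict inequalities along a chain. -/

/-- Propagation along a chain of real parameters: if each interior parameter can be moved
so that the values of its two links drop below `V` as soon as one of them is below `V`, then
one link below `V` allows to move all of them below `V`. -/
theorem exists_chain_lt {M : ℕ} {A : ℕ → ℝ → ℝ → Prop} {X : ℕ → ℝ → ℝ → ℝ} {V : ℝ}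
    (step : ∀ i, i + 1 < M → ∀ u v t, A i u v → A (i + 1) v t → X i u v ≤ V → X (i + 1) v t ≤ V →
      (X i u v < V ∨ X (i + 1) v t < V) →
      ∃ v', A i u v' ∧ A (i + 1) v' t ∧ X i u v' < V ∧ X (i + 1) v' t < V)
    (w : ℕ → ℝ) (hA : ∀ i < M, A i (w i) (w (i + 1))) (hX : ∀ i < M, X i (w i) (w (i + 1)) ≤ V)
    {j : ℕ} (hj : j < M) (hjV : X j (w j) (w (j + 1)) < V) :
    ∃ w' : ℕ → ℝ, w' 0 = w 0 ∧
      ∀ i < M, A i (w' i) (w' (i + 1)) ∧ X i (w' i) (w' (i + 1)) < V := by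
  let P : (ℕ → ℝ) → Prop := fun y => y 0 = w 0 ∧ (∀ i < M, A i (y i) (y (i + 1))) ∧
    ∀ i < M, X i (y i) (y (i + 1)) ≤ V
  -- One move makes links i and i + 1 strict and keeps every other strict link, since only the
  -- parameter i + 1 changes. Sweeping right from j and then left makes all links strict; parameter
  -- 0 is never touched.
  have one : ∀ y, P y → ∀ i, i + 1 < M →
      (X i (y i) (y (i + 1)) < V ∨ X (i + 1) (y (i + 1)) (y (i + 1 + 1)) < V) →
      ∃ y', P y' ∧ ∀ l, l < M → (X l (y l) (y (l + 1)) < V ∨ l = i ∨ l = i + 1) →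
        X l (y' l) (y' (l + 1)) < V := by
    rintro y ⟨h0, hyA, hyX⟩ i hi hlt
    obtain ⟨v', h1, h2, h3, h4⟩ := step i hi _ _ _ (hyA i (by omega)) (hyA (i + 1) hi)
      (hyX i (by omega)) (hyX (i + 1) hi) hlt
    have key : ∀ l, l = i ∨ l = i + 1 ∨ (Function.update y (i + 1) v' l = y l ∧
        Function.update y (i + 1) v' (l + 1) = y (l + 1)) := by
      intro l
      by_cases h : l = i
      · exact Or.inl h
      by_cases h' : l = i + 1
      · exact Or.inr (Or.inl h')
      · refine Or.inr (Or.inr ⟨Function.update_of_ne h' _ _, Function.update_of_ne ?_ _ _⟩)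
        omega
    have e0 : Function.update y (i + 1) v' i = y i := Function.update_of_ne (by omega) _ _
    have e1 : Function.update y (i + 1) v' (i + 1) = v' := Function.update_self _ _ _
    have e2 : Function.update y (i + 1) v' (i + 1 + 1) = y (i + 1 + 1) :=
      Function.update_of_ne (by omega) _ _
    refine ⟨Function.update y (i + 1) v', ⟨?_, ?_, ?_⟩, ?_⟩
    · rw [Function.update_of_ne (by omega), h0]
    · intro l hl
      rcases key l with rfl | rfl | ⟨a, b⟩
      · rwa [e0, e1]
      · rwa [e1, e2]
      · rw [a, b]; exact hyA l hl
    · intro l hl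
      rcases key l with rfl | rfl | ⟨a, b⟩
      · rw [e0, e1]; exact h3.le
      · rw [e1, e2]; exact h4.le
      · rw [a, b]; exact hyX l hl
    · intro l hl h
      rcases key l with rfl | rfl | ⟨a, b⟩
      · rwa [e0, e1]
      · rwa [e1, e2]
      · rw [a, b]
        rcases h with h | rfl | rfl
        · exact h
        · rw [← a, ← b, e0, e1]; exact h3
        · rw [← a, ← b, e1, e2]; exact h4
  have right : ∀ d, j + d < M → ∃ y, P y ∧ ∀ l, j ≤ l → l ≤ j + d → X l (y l) (y (l + 1)) < V := by
    intro d
    induction d with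
    | zero =>
      intro _
      refine ⟨w, ⟨rfl, hA, hX⟩, fun l h1 h2 => ?_⟩
      obtain rfl : l = j := by omega
      exact hjV
    | succ d ih =>
      intro hd
      obtain ⟨y, hy, hlt⟩ := ih (by omega)
      obtain ⟨y', hy', h⟩ := one y hy (j + d) (by omega) (Or.inl (hlt _ (by omega) le_rfl))
      refine ⟨y', hy', fun l h1 h2 => h l (by omega) ?_⟩
      by_cases hl : l ≤ j + d
      · exact Or.inl (hlt l h1 hl)
      · right; right; omega
  have left : ∀ d, d ≤ j → ∃ y, P y ∧ ∀ l, j ≤ l + d → l < M → X l (y l) (y (l + 1)) < V := by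
    intro d
    induction d with
    | zero =>
      intro _
      obtain ⟨y, hy, h⟩ := right (M - 1 - j) (by omega)
      exact ⟨y, hy, fun l h1 h2 => h l (by omega) (by omega)⟩
    | succ d ih =>
      intro hd
      obtain ⟨y, hy, hlt⟩ := ih (by omega)
      obtain ⟨y', hy', h⟩ := one y hy (j - (d + 1)) (by omega)
        (Or.inr (hlt _ (by omega) (by omega)))
      refine ⟨y', hy', fun l h1 h2 => h l h2 ?_⟩
      by_cases hl : j ≤ l + d
      · exact Or.inl (hlt l hl h2)
      · right; left; omega
  obtain ⟨y, ⟨h0, hyA, -⟩, h⟩ := left j le_rfl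
  exact ⟨y, h0, fun i hi => ⟨hyA i hi, h i (by omega) hi⟩⟩

/-! ### Abstract families of failure curves. -/

/-- The failure probability at `l` for the phase ratio `c`, in terms of `D`. -/
def failure (D : ℝ → ℝ) (c l : ℝ) : ℝ := (1 - l) * D (c * l) ^ 2

/-- The properties of `D`, on `[p, q)`, that govern the failure probabilities `(1 - l) * D (c l) ^ 2`
for `p / q < c ≤ 1`: a zero at `p / c`, then growth up to the maximum at `K c`. -/
structure PhaseFamily (p q : ℝ) (D K : ℝ → ℝ) : Prop where
  pos : 0 < p
  lt : p < q
  le_one : q ≤ 1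
  cont : Continuous D
  anti : StrictAntiOn D (Icc 0 q)
  zero : D p = 0
  key_gt : ∀ c ∈ Ioc (p / q) 1, p < c * K c
  key_le : ∀ c ∈ Ioc (p / q) 1, K c ≤ q
  key_lt_one : ∀ c ∈ Ioc (p / q) 1, K c < 1
  key_cont : ∀ c ∈ Ioc (p / q) 1, ContinuousAt K c
  mono : ∀ c ∈ Ioc (p / q) 1, ∀ l l', p ≤ c * l → l < l' → l' ≤ K c →
    failure D c l < failure D c l'
  le_key : ∀ c ∈ Ioc (p / q) 1, ∀ l, p ≤ c * l → l ≤ q → failure D c l ≤ failure D c (K c)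
  cross_lt_key : ∀ c ∈ Ioc (p / q) 1, ∀ c' ∈ Ioc (p / q) 1, c' < c → ∀ l, 0 < l → l < q →
    D (c * l) + D (c' * l) = 0 → l < K c

namespace PhaseFamily

variable {p q : ℝ} {D K : ℝ → ℝ}

theorem continuous_failure (F : PhaseFamily p q D K) {X : Type*} [TopologicalSpace X]
    {c l : X → ℝ} (hc : Continuous c) (hl : Continuous l) :
    Continuous fun x => failure D (c x) (l x) := by
  have := F.cont
  unfold failure
  fun_prop

theorem ratio_pos (F : PhaseFamily p q D K) {c : ℝ} (hc : c ∈ Ioc (p / q) 1) : 0 < c :=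
  (div_pos F.pos (F.pos.trans F.lt)).trans hc.1

theorem lt_mul (F : PhaseFamily p q D K) {c : ℝ} (hc : c ∈ Ioc (p / q) 1) : p < c * q := by
  have := hc.1
  rwa [div_lt_iff₀ (F.pos.trans F.lt)] at this

theorem nonneg_of_le (F : PhaseFamily p q D K) {y : ℝ} (h0 : 0 ≤ y) (h : y ≤ p) : 0 ≤ D y := by
  rw [← F.zero]
  exact F.anti.antitoneOn ⟨h0, h.trans F.lt.le⟩ ⟨F.pos.le, F.lt.le⟩ h

theorem nonpos_of_ge (F : PhaseFamily p q D K) {y : ℝ} (h : p ≤ y) (hq : y ≤ q) : D y ≤ 0 := by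
  rw [← F.zero]
  exact F.anti.antitoneOn ⟨F.pos.le, F.lt.le⟩ ⟨F.pos.le.trans h, hq⟩ h

theorem sq_lt_of_le_zero (F : PhaseFamily p q D K) {x y : ℝ} (h0 : 0 ≤ x) (hxy : x < y)
    (hy : y ≤ p) : D y ^ 2 < D x ^ 2 :=
  pow_lt_pow_left₀ (F.anti ⟨h0, by linarith [F.lt]⟩ ⟨by linarith, by linarith [F.lt]⟩ hxy)
    (F.nonneg_of_le (by linarith) hy) two_ne_zero

theorem sq_lt_of_ge_zero (F : PhaseFamily p q D K) {x y : ℝ} (hx : p ≤ x) (hxy : x < y)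
    (hy : y ≤ q) : D x ^ 2 < D y ^ 2 := by
  have h := F.anti ⟨by linarith [F.pos], by linarith⟩ ⟨by linarith [F.pos], hy⟩ hxy
  have := F.nonpos_of_ge hx (by linarith)
  nlinarith

/-- To the left of the zero, a larger ratio or a larger argument lowers the failure. -/
theorem failure_lt_left (F : PhaseFamily p q D K) {c c' l : ℝ} (hc : 0 ≤ c) (hl : 0 < l)
    (hl1 : l < 1) (h : c < c') (hp : c' * l ≤ p) : failure D c' l < failure D c l :=
  mul_lt_mul_of_pos_left (F.sq_lt_of_le_zero (by positivity) (by gcongr) hp) (by linarith)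

theorem failure_lt_right (F : PhaseFamily p q D K) {c c' l : ℝ} (hl : 0 < l) (hl1 : l < 1)
    (h : c < c') (hp : p ≤ c * l) (hq : c' * l ≤ q) : failure D c l < failure D c' l :=
  mul_lt_mul_of_pos_left (F.sq_lt_of_ge_zero hp (by gcongr) hq) (by linarith)

theorem failure_lt_of_lt (F : PhaseFamily p q D K) {c l l' : ℝ} (hc : 0 < c) (hl : 0 ≤ l)
    (hl1 : l' < 1) (h : l < l') (hp : c * l' ≤ p) : failure D c l' < failure D c l := by
  have h1 := F.sq_lt_of_le_zero (x := c * l) (y := c * l') (by positivity) (by gcongr) hp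
  unfold failure
  have := sq_nonneg (D (c * l'))
  nlinarith

theorem failure_nonneg {c l : ℝ} (hl : l ≤ 1) : 0 ≤ failure D c l :=
  mul_nonneg (by linarith) (sq_nonneg _)

theorem failure_eq_zero (F : PhaseFamily p q D K) {c l : ℝ} (h : c * l = p) :
    failure D c l = 0 := by
  simp [failure, h, F.zero]

end PhaseFamily

/-! ### Crossings, separating points and the pigeonhole bound. -/

/-- The points `p = b 0, b 1, …, b (n - 1)` separate the zeros `p / c m`, with `b m` before the
maximum of the `m`-th failure curve. -/
structure Separates (p : ℝ) (K : ℝ → ℝ) (n : ℕ) (c b : ℕ → ℝ) : Prop where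
  zero : b 0 = p
  left : ∀ m, m < n → p ≤ b m ∧ c (m + 1) * b m ≤ p
  right : ∀ m, 1 ≤ m → m < n → p < c m * b m ∧ b m < K (c m)

namespace PhaseFamily

variable {p q : ℝ} {D K : ℝ → ℝ}

/-- Equal failures mean equal squares of D; strict monotonicity rules out equal values, so crossings
are the zeros of D(cl) + D(c'l). This sum is strictly decreasing, positive at p and negative at q.
-/
theorem existsUnique_crossing (F : PhaseFamily p q D K) {c c' : ℝ} (hc : c ∈ Ioc (p / q) 1)
    (hc' : c' ∈ Ioc (p / q) 1) (h : c' < c) :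
    ∃! l, l ∈ Ico p q ∧ failure D c l = failure D c' l := by
  have hp := F.pos
  have hpq := F.lt
  have c0 := F.ratio_pos hc
  have c0' := F.ratio_pos hc'
  have hmem : ∀ {d}, d ∈ Ioc (p / q) 1 → ∀ {l}, l ∈ Icc p q → d * l ∈ Icc 0 q := by
    intro d hd l hl
    have := F.ratio_pos hd
    exact ⟨mul_nonneg this.le (by linarith [hl.1]), by nlinarith [hl.1, hl.2, hd.2]⟩
  have hanti : StrictAntiOn (fun l => D (c * l) + D (c' * l)) (Icc p q) := by
    intro x hx y hy hxy
    have h1 := F.anti (hmem hc hx) (hmem hc hy) (by gcongr)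
    have h2 := F.anti (hmem hc' hx) (hmem hc' hy) (by gcongr)
    show D (c * y) + D (c' * y) < D (c * x) + D (c' * x)
    linarith
  have hiff : ∀ l ∈ Ico p q, failure D c l = failure D c' l ↔ D (c * l) + D (c' * l) = 0 := by
    intro l hl
    have hl' : l ∈ Icc p q := ⟨hl.1, hl.2.le⟩
    have h1 := F.anti (hmem hc' hl') (hmem hc hl') (by nlinarith [hl.1])
    have h2 : (1 - l) ≠ 0 := by linarith [hl.2, F.le_one]
    unfold failure
    rw [mul_right_inj' h2, sq_eq_sq_iff_eq_or_eq_neg]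
    constructor
    · rintro (h | h) <;> linarith
    · intro h; right; linarith
  have hcont : ContinuousOn (fun l => D (c * l) + D (c' * l)) (Icc p q) := by
    have := F.cont
    fun_prop
  have hP : 0 < D (c * p) + D (c' * p) := by
    have h1 : 0 ≤ D (c * p) := F.nonneg_of_le (by positivity) (by nlinarith [hc.2])
    have h2 : D p < D (c' * p) :=
      F.anti ⟨by positivity, by nlinarith [hc'.2]⟩ ⟨hp.le, hpq.le⟩ (by nlinarith [hc.2])
    rw [F.zero] at h2
    linarith
  have hQ : D (c * q) + D (c' * q) < 0 := by
    have h1 : D (c * q) < D p :=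
      F.anti ⟨hp.le, hpq.le⟩ (hmem hc ⟨hpq.le, le_rfl⟩) (F.lt_mul hc)
    have h2 : D (c' * q) < D p :=
      F.anti ⟨hp.le, hpq.le⟩ (hmem hc' ⟨hpq.le, le_rfl⟩) (F.lt_mul hc')
    rw [F.zero] at h1 h2
    linarith
  obtain ⟨l, hl, hl0⟩ := intermediate_value_Icc' hpq.le hcont ⟨hQ.le, hP.le⟩
  have hlq : l ≠ q := by rintro rfl; exact hQ.ne hl0
  have hl' : l ∈ Ico p q := ⟨hl.1, lt_of_le_of_ne hl.2 hlq⟩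
  refine ⟨l, ⟨hl', (hiff l hl').2 hl0⟩, ?_⟩
  rintro y ⟨hy, hy'⟩
  exact hanti.injOn ⟨hy.1, hy.2.le⟩ hl (((hiff y hy).1 hy').trans hl0.symm)

/-- If both arguments were on the same side of the zero of D, the failures would be strictly
ordered; hence the crossing lies strictly between the two zeros p/c and p/c'. -/
theorem crossing_props (F : PhaseFamily p q D K) {c c' l : ℝ} (hc : c ∈ Ioc (p / q) 1)
    (hc' : c' ∈ Ioc (p / q) 1) (h : c' < c) (hl : l ∈ Ico p q)
    (he : failure D c l = failure D c' l) : p < c * l ∧ c' * l < p ∧ l < K c := by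
  have hp := F.pos
  have hpq := F.lt
  have c0 := F.ratio_pos hc
  have c0' := F.ratio_pos hc'
  have hl0 : 0 < l := hp.trans_le hl.1
  have hl1 : l < 1 := hl.2.trans_le F.le_one
  have hlt : c' * l < c * l := by gcongr
  have hcq : c * l ≤ q := by nlinarith [hl.2, hc.2]
  have h1 : p < c * l := by
    by_contra! hn
    exact (F.failure_lt_left c0'.le hl0 hl1 h hn).ne he
  have h2 : c' * l < p := by
    by_contra! hn
    exact (F.failure_lt_right hl0 hl1 h hn hcq).ne he.symm
  refine ⟨h1, h2, F.cross_lt_key c hc c' hc' h l hl0 hl.2 ?_⟩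
  have hlt' := F.anti ⟨by positivity, by linarith⟩ ⟨by positivity, hcq⟩ hlt
  have h3 : (1 - l) ≠ 0 := by linarith
  unfold failure at he
  rw [mul_right_inj' h3, sq_eq_sq_iff_eq_or_eq_neg] at he
  rcases he with he | he <;> linarith

theorem separates (F : PhaseFamily p q D K) {n : ℕ} {c a : ℕ → ℝ}
    (hc : ∀ m ∈ Icc 1 n, c m ∈ Ioc (p / q) 1) (hanti : StrictAntiOn c (Icc 1 n)) (h0 : a 0 = p)
    (ha : ∀ m, 1 ≤ m → m < n → a m ∈ Ico p q ∧ failure D (c m) (a m) = failure D (c (m + 1)) (a m)) :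
    Separates p K n c a := by
  have key : ∀ m, 1 ≤ m → m < n → p < c m * a m ∧ c (m + 1) * a m < p ∧ a m < K (c m) := by
    intro m h1 h2
    exact F.crossing_props (hc m ⟨h1, h2.le⟩) (hc (m + 1) ⟨by omega, h2⟩)
      (hanti ⟨h1, h2.le⟩ ⟨by omega, h2⟩ (by omega)) (ha m h1 h2).1 (ha m h1 h2).2
  refine ⟨h0, fun m hm => ?_, fun m h1 h2 => ⟨(key m h1 h2).1, (key m h1 h2).2.2⟩⟩
  rcases Nat.eq_zero_or_pos m with rfl | h1
  · rw [h0]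
    exact ⟨le_rfl, by nlinarith [(hc 1 ⟨le_rfl, hm⟩).2, F.pos]⟩
  · exact ⟨(ha m h1 hm).1.1, (key m h1 hm).2.1.le⟩

/-- Up to K c the curve falls to its zero and then rises, so on an interval its largest value is at
an end. -/
theorem failure_le_max (F : PhaseFamily p q D K) {c x y l v : ℝ} (hc : c ∈ Ioc (p / q) 1)
    (hx : 0 ≤ x) (hxl : x ≤ l) (hly : l ≤ y) (hl1 : l < 1) (hy : y ≤ K c)
    (hvx : failure D c x ≤ v) (hvy : failure D c y ≤ v) : failure D c l ≤ v := by
  rcases le_total (c * l) p with h | h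
  · rcases hxl.eq_or_lt with rfl | h'
    · exact hvx
    · exact (F.failure_lt_of_lt (F.ratio_pos hc) hx hl1 h' h).le.trans hvx
  · rcases hly.eq_or_lt with rfl | h'
    · exact hvy
    · exact (F.mono c hc l y h h' hy).le.trans hvy

/-- Bounds at the separating points and at the last maximum are bounds on all of `[p, q)`. -/
theorem exists_failure_le (F : PhaseFamily p q D K) {n : ℕ} (hn : 1 ≤ n) {c b : ℕ → ℝ} {v : ℝ}
    (hc : ∀ m ∈ Icc 1 n, c m ∈ Ioc (p / q) 1) (hs : Separates p K n c b)
    (hL : ∀ m, m < n → failure D (c (m + 1)) (b m) ≤ v)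
    (hR : ∀ m, 1 ≤ m → m < n → failure D (c m) (b m) ≤ v)
    (hK : failure D (c n) (K (c n)) ≤ v) {l : ℝ} (hl : l ∈ Ico p q) :
    ∃ m ∈ Icc 1 n, failure D (c m) l ≤ v := by
  classical
  have hl1 : l < 1 := hl.2.trans_le F.le_one
  -- The last separating point not beyond l selects the curve; the final curve serves everything up
  -- to q, where `le_key` replaces a right-hand separating point.
  let s := (Finset.range n).filter fun m => b m ≤ l
  have hs0 : s.Nonempty := by
    refine ⟨0, ?_⟩
    simp only [s, Finset.mem_filter, Finset.mem_range, hs.zero]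
    exact ⟨hn, hl.1⟩
  obtain ⟨m, hm, hmax⟩ := s.exists_max_image id hs0
  simp only [s, Finset.mem_filter, Finset.mem_range, id] at hm hmax
  have hb0 : 0 ≤ b m := F.pos.le.trans (hs.left m hm.1).1
  refine ⟨m + 1, ⟨by omega, hm.1⟩, ?_⟩
  have hcm := hc (m + 1) ⟨by omega, hm.1⟩
  rcases Nat.lt_or_ge (m + 1) n with h | h
  · have hlb : l ≤ b (m + 1) := by
      by_contra! hlt
      have := hmax (m + 1) ⟨h, hlt.le⟩
      omega
    exact F.failure_le_max hcm hb0 hm.2 hlb hl1 (hs.right (m + 1) (by omega) h).2.le (hL m hm.1)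
      (hR (m + 1) (by omega) h)
  · obtain rfl : m + 1 = n := by omega
    rcases le_total (c (m + 1) * l) p with h' | h'
    · rcases hm.2.eq_or_lt with h'' | h''
      · rw [← h'']; exact hL m hm.1
      · exact (F.failure_lt_of_lt (F.ratio_pos hcm) hb0 hl1 h'' h').le.trans (hL m hm.1)
    · exact (F.le_key _ hcm l h' hl.2.le).trans hK

/-- `n` curves cannot all lie below the common value of `n` other curves at the separating points
and at the last maximum. -/
theorem le_of_equalized (F : PhaseFamily p q D K) {n : ℕ} (hn : 1 ≤ n) {c b d : ℕ → ℝ} {e v : ℝ}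
    (hc : ∀ m ∈ Icc 1 n, c m ∈ Ioc (p / q) 1) (hs : Separates p K n c b)
    (hL : ∀ m, m < n → failure D (c (m + 1)) (b m) = e)
    (hR : ∀ m, 1 ≤ m → m < n → failure D (c m) (b m) = e)
    (hK : failure D (c n) (K (c n)) = e)
    (hd : ∀ m ∈ Icc 1 n, d m ∈ Ioc (p / q) 1)
    (hv : ∀ l ∈ Icc p q, ∃ m ∈ Icc 1 n, failure D (d m) l ≤ v) : e ≤ v := by
  by_contra! hlt
  have hp := F.pos
  -- Failure below e at the j-th point confines the ratio to (c (j+1), c j); the first point gives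
  -- no upper bound and the point K (c n), with j = n, no lower one.
  have key : ∀ j : Fin (n + 1), ∃ m ∈ Icc 1 n, (j.1 < n → c (j.1 + 1) < d m) ∧
      (1 ≤ j.1 → d m < c j.1) := by
    rintro ⟨j, hj⟩
    simp only
    rcases Nat.lt_or_ge j n with h | h
    · have hcj := hc (j + 1) ⟨by omega, h⟩
      have hbq : b j < q := by
        rcases Nat.eq_zero_or_pos j with rfl | h1
        · rw [hs.zero]; exact F.lt
        · exact (hs.right j h1 h).2.trans_le (F.key_le _ (hc j ⟨h1, h.le⟩))
      have hb1 : b j < 1 := hbq.trans_le F.le_one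
      have hb0 : 0 < b j := hp.trans_le (hs.left j h).1
      obtain ⟨m, hm, hfm⟩ := hv (b j) ⟨(hs.left j h).1, hbq.le⟩
      refine ⟨m, hm, fun _ => ?_, fun h1 => ?_⟩
      · by_contra! hn'
        rcases hn'.eq_or_lt with h' | h'
        · rw [h', hL j h] at hfm; linarith
        · have := F.failure_lt_left (F.ratio_pos (hd m hm)).le hb0 hb1 h' (hs.left j h).2
          rw [hL j h] at this; linarith
      · by_contra! hn'
        rcases hn'.eq_or_lt with h' | h'
        · rw [← h', hR j h1 h] at hfm; linarith
        · have := F.failure_lt_right hb0 hb1 h' (hs.right j h1 h).1.le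
            (by nlinarith [(hd m hm).2])
          rw [hR j h1 h] at this; linarith
    · obtain rfl : j = n := by omega
      have hcj := hc j ⟨hn, le_rfl⟩
      have h1 := F.key_gt _ hcj
      have hK0 : 0 < K (c j) := by
        by_contra! h0
        nlinarith [F.ratio_pos hcj]
      have hpK : p ≤ K (c j) := by nlinarith [hcj.2]
      obtain ⟨m, hm, hfm⟩ := hv (K (c j)) ⟨hpK, F.key_le _ hcj⟩
      refine ⟨m, hm, fun h0 => by omega, fun _ => ?_⟩
      by_contra! hn'
      rcases hn'.eq_or_lt with h' | h'
      · rw [← h', hK] at hfm; linarith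
      · have := F.failure_lt_right hK0 (F.key_lt_one _ hcj) h' h1.le
          (by nlinarith [(hd m hm).2, F.key_le _ hcj])
        rw [hK] at this; linarith
  have hanti : ∀ i j, 1 ≤ i → i ≤ j → j ≤ n → c j ≤ c i := by
    intro i j hi hij
    induction j, hij using Nat.le_induction with
    | base => intro _; exact le_rfl
    | succ j hij ih =>
      intro hj
      refine le_trans ?_ (ih (by omega))
      have h1 := (hs.left j (by omega)).2
      have h2 := (hs.right j (by omega) (by omega)).1
      have h3 : 0 < b j := hp.trans_le (hs.left j (by omega)).1
      exact (lt_of_mul_lt_mul_right (h1.trans_lt h2) h3.le).le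
  choose g hg hg1 hg2 using key
  -- Two of the n + 1 points share a ratio, say at i < j, giving c (i+1) < d < c j ≤ c (i+1).
  have hcard : (Finset.Icc 1 n).card < (Finset.univ : Finset (Fin (n + 1))).card := by simp
  obtain ⟨i, -, j, -, hij, hgij⟩ := Finset.exists_ne_map_eq_of_card_lt_of_maps_to hcard
    (f := g) (fun j _ => by simpa using hg j)
  wlog hlt' : i < j generalizing i j
  · exact this j i hij.symm hgij.symm (lt_of_le_of_ne (not_lt.1 hlt') hij.symm)
  have h1 := hg1 i (by omega)
  have h2 := hg2 j (by omega)
  have h3 := hanti (i + 1) j (by omega) (by omega) (by omega)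
  rw [hgij] at h1
  linarith

end PhaseFamily

/-! ### The perturbation argument. -/

namespace PhaseFamily

variable {p q : ℝ} {D K : ℝ → ℝ}

theorem eventually_failure_lt (F : PhaseFamily p q D K) {c l : ℝ → ℝ} {x V : ℝ}
    (hc : ContinuousAt c x) (hl : ContinuousAt l x) (h : failure D (c x) (l x) < V) :
    ∀ᶠ y in 𝓝 x, failure D (c y) (l y) < V := by
  have hD := F.cont
  have : ContinuousAt (fun y => failure D (c y) (l y)) x := by
    unfold failure
    exact (continuousAt_const.sub hl).mul ((hD.continuousAt.comp (hc.mul hl)).pow 2)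
  exact this.eventually_lt continuousAt_const h

/-- Moving a separating point. -/
theorem exists_point_lt (F : PhaseFamily p q D K) {c c' b V : ℝ} (hc : c ∈ Ioc (p / q) 1)
    (hc' : c' ∈ Ioc (p / q) 1) (h1 : p < c * b) (h2 : b < K c) (h3 : p ≤ b) (h4 : c' * b ≤ p)
    (hV : failure D c b ≤ V) (hV' : failure D c' b ≤ V)
    (hlt : failure D c b < V ∨ failure D c' b < V) :
    ∃ x, p < c * x ∧ x < K c ∧ p ≤ x ∧ c' * x ≤ p ∧ failure D c x < V ∧ failure D c' x < V := by
  have c0 := F.ratio_pos hc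
  have c0' := F.ratio_pos hc'
  have hb1 : b < 1 := h2.trans (F.key_lt_one c hc)
  have hb0 : 0 < b := F.pos.trans_le h3
  have hVpos : 0 < V := by
    rcases hlt with h | h
    exacts [(failure_nonneg hb1.le).trans_lt h, (failure_nonneg hb1.le).trans_lt h]
  have hev : ∀ᶠ x in 𝓝 b, p < c * x ∧ x < K c ∧ x < 1 ∧ 0 < x :=
    ((continuousAt_const.eventually_lt (by fun_prop) h1).and
      ((eventually_lt_nhds h2).and ((eventually_lt_nhds hb1).and (eventually_gt_nhds hb0))))
  rcases hV.eq_or_lt with hVe | hVl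
  · have hlt' : failure D c' b < V := by
      rcases hlt with h | h
      · exact absurd hVe h.ne
      · exact h
    -- There is room on the left because p < c b ≤ b. Moving b left lowers the rising branch of c,
    -- and the slack in the other curve absorbs the change.
    have hpb : p < b := by nlinarith [hc.2]
    have e1 := F.eventually_failure_lt (x := b) (continuousAt_const (y := c')) continuousAt_id hlt'
    have e2 : ∀ᶠ x in 𝓝 b, p < x := eventually_gt_nhds hpb
    have := ((hev.and (e1.and e2)).filter_mono nhdsWithin_le_nhds).and
      (self_mem_nhdsWithin : Iio b ∈ 𝓝[<] b)
    obtain ⟨x, ⟨⟨g1, g2, g3, g4⟩, g5, g6⟩, g7⟩ := this.exists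
    exact ⟨x, g1, g2, g6.le, (mul_le_mul_of_nonneg_left (le_of_lt g7) c0'.le).trans h4,
      (F.mono c hc x b g1.le g7 h2.le).trans_eq hVe, g5⟩
  · rcases hV'.eq_or_lt with hVe' | hVl'
    · have hne : c' * b < p := by
        refine lt_of_le_of_ne h4 fun h => ?_
        rw [F.failure_eq_zero h] at hVe'
        linarith
      have e1 := F.eventually_failure_lt (x := b) (continuousAt_const (y := c)) continuousAt_id hVl
      have e2 : ∀ᶠ x in 𝓝 b, c' * x < p :=
        ContinuousAt.eventually_lt (by fun_prop) continuousAt_const hne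
      have := ((hev.and (e1.and e2)).filter_mono nhdsWithin_le_nhds).and
        (self_mem_nhdsWithin : Ioi b ∈ 𝓝[>] b)
      obtain ⟨x, ⟨⟨g1, g2, g3, g4⟩, g5, g6⟩, g7⟩ := this.exists
      exact ⟨x, g1, g2, h3.trans (le_of_lt g7), g6.le, g5,
        (F.failure_lt_of_lt c0' hb0.le g3 g7 g6.le).trans_eq hVe'⟩
    · exact ⟨b, h1, h2, h3, h4, hVl, hVl'⟩

/-- Moving a ratio, given the separating point `b` to the left of its zero and any open condition `Q`
and continuous bound `Y` to the right of it that drops when the ratio is lowered. -/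
theorem exists_ratio_lt_of (F : PhaseFamily p q D K) {c b V : ℝ} {Q : ℝ → Prop} {Y : ℝ → ℝ}
    (hc : c ∈ Ioc (p / q) 1) (h3 : p ≤ b) (hb1 : b < 1) (h4 : c * b ≤ p) (hQ : ∀ᶠ x in 𝓝 c, Q x)
    (hY : Y c < V → ∀ᶠ x in 𝓝 c, Y x < V) (hYlt : ∀ᶠ x in 𝓝[<] c, Y x < Y c) (hY0 : 0 ≤ Y c)
    (hV : failure D c b ≤ V) (hV' : Y c ≤ V) (hlt : failure D c b < V ∨ Y c < V) :
    ∃ x ∈ Ioc (p / q) 1, x * b ≤ p ∧ Q x ∧ failure D x b < V ∧ Y x < V := by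
  have c0 := F.ratio_pos hc
  have hb0 : 0 < b := F.pos.trans_le h3
  have hVpos : 0 < V := by
    rcases hlt with h | h
    exacts [(failure_nonneg hb1.le).trans_lt h, hY0.trans_lt h]
  rcases hV'.eq_or_lt with hVe | hVl
  · have hlt' : failure D c b < V := by
      rcases hlt with h | h
      · exact h
      · exact absurd hVe h.ne
    have e1 := F.eventually_failure_lt (x := c) continuousAt_id (continuousAt_const (y := b)) hlt'
    have e2 : ∀ᶠ x in 𝓝 c, p / q < x := eventually_gt_nhds hc.1
    have := ((hQ.and (e1.and e2)).filter_mono nhdsWithin_le_nhds).and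
      (hYlt.and (self_mem_nhdsWithin : Iio c ∈ 𝓝[<] c))
    obtain ⟨x, ⟨g1, g2, g3⟩, g4, g5⟩ := this.exists
    have g5' : x < c := g5
    exact ⟨x, ⟨g3, g5'.le.trans hc.2⟩, (by nlinarith), g1, g2, g4.trans_eq hVe⟩
  · rcases hV.eq_or_lt with hVe' | hVl'
    · have hne : c * b < p := by
        refine lt_of_le_of_ne h4 fun h => ?_
        rw [F.failure_eq_zero h] at hVe'
        linarith
      -- The bounds c b < p ≤ b leave room to increase c without exceeding 1.
      have hc1 : c < 1 := by nlinarith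
      have e1 : ∀ᶠ x in 𝓝 c, x * b < p :=
        ContinuousAt.eventually_lt (by fun_prop) continuousAt_const hne
      have e2 : ∀ᶠ x in 𝓝 c, x < 1 := eventually_lt_nhds hc1
      have := ((hQ.and ((hY hVl).and (e1.and e2))).filter_mono nhdsWithin_le_nhds).and
        (self_mem_nhdsWithin : Ioi c ∈ 𝓝[>] c)
      obtain ⟨x, ⟨g1, g2, g3, g4⟩, g5⟩ := this.exists
      have g5' : c < x := g5
      exact ⟨x, ⟨hc.1.trans g5', g4.le⟩, g3.le, g1,
        (F.failure_lt_left c0.le hb0 hb1 g5' g3.le).trans_eq hVe', g2⟩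
    · exact ⟨c, hc, h4, hQ.self_of_nhds, hVl', hVl⟩

theorem exists_ratio_lt (F : PhaseFamily p q D K) {c b b' V : ℝ} (hc : c ∈ Ioc (p / q) 1)
    (h3 : p ≤ b) (h4 : c * b ≤ p) (h1 : p < c * b') (h2 : b' < K c)
    (hV : failure D c b ≤ V) (hV' : failure D c b' ≤ V)
    (hlt : failure D c b < V ∨ failure D c b' < V) :
    ∃ x ∈ Ioc (p / q) 1, x * b ≤ p ∧ (p < x * b' ∧ b' < K x) ∧
      failure D x b < V ∧ failure D x b' < V := by
  have c0 := F.ratio_pos hc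
  have hb1' : b' < 1 := h2.trans (F.key_lt_one c hc)
  have hbb : b < b' := lt_of_mul_lt_mul_left (h4.trans_lt h1) c0.le
  have hb0' : 0 < b' := (F.pos.trans_le h3).trans hbb
  have e1 : ∀ᶠ x in 𝓝 c, p < x * b' :=
    ContinuousAt.eventually_lt continuousAt_const (by fun_prop) h1
  refine F.exists_ratio_lt_of (Q := fun x => p < x * b' ∧ b' < K x) (Y := fun x => failure D x b')
    hc h3 (hbb.trans hb1') h4 (e1.and (continuousAt_const.eventually_lt (F.key_cont c hc) h2))
    (fun h => F.eventually_failure_lt continuousAt_id continuousAt_const h) ?_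
    (failure_nonneg hb1'.le) hV hV' hlt
  · filter_upwards [e1.filter_mono nhdsWithin_le_nhds, self_mem_nhdsWithin] with x g1 g2
    exact F.failure_lt_right hb0' hb1' g2 g1.le (by nlinarith [hc.2, F.key_le c hc])

theorem exists_last_ratio_lt (F : PhaseFamily p q D K) {c b V : ℝ} (hc : c ∈ Ioc (p / q) 1)
    (h3 : p ≤ b) (h4 : c * b ≤ p)
    (hV : failure D c b ≤ V) (hV' : failure D c (K c) ≤ V)
    (hlt : failure D c b < V ∨ failure D c (K c) < V) :
    ∃ x ∈ Ioc (p / q) 1, x * b ≤ p ∧ failure D x b < V ∧ failure D x (K x) < V := by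
  have c0 := F.ratio_pos hc
  have hbK : b < K c := lt_of_mul_lt_mul_left (h4.trans_lt (F.key_gt c hc)) c0.le
  -- The location of the maximum moves with the ratio, so two comparisons are used: failure at K x
  -- drops from c to x, and the value of c at K x is at most its value at K c.
  have hYlt : ∀ᶠ x in 𝓝[<] c, failure D x (K x) < failure D c (K c) := by
    filter_upwards [(eventually_gt_nhds hc.1).filter_mono nhdsWithin_le_nhds,
      self_mem_nhdsWithin] with x g1 g2
    have g2' : x < c := g2
    have hx : x ∈ Ioc (p / q) 1 := ⟨g1, g2'.le.trans hc.2⟩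
    have h5 := F.key_gt x hx
    have h6 := F.key_le x hx
    have x0 := F.ratio_pos hx
    have hK0 : 0 < K x := by
      by_contra! h0
      nlinarith [F.pos]
    exact (F.failure_lt_right hK0 (F.key_lt_one x hx) g2' h5.le (by nlinarith [hc.2])).trans_le
      (F.le_key c hc _ (by nlinarith) h6)
  obtain ⟨x, hx, g1, -, g2, g3⟩ := F.exists_ratio_lt_of (Q := fun _ => True)
    (Y := fun x => failure D x (K x))
    hc h3 (hbK.trans (F.key_lt_one c hc)) h4 (Eventually.of_forall fun _ => trivial)
    (fun h => F.eventually_failure_lt continuousAt_id (F.key_cont c hc) h) hYlt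
    (failure_nonneg (F.key_lt_one c hc).le) hV hV' hlt
  exact ⟨x, hx, g1, g2, g3⟩

/-- If the values at the separating points and at the last maximum are not all equal to `V`,
other ratios do better than `V`. -/
theorem exists_better (F : PhaseFamily p q D K) {n : ℕ} (hn : 1 ≤ n) {c b : ℕ → ℝ} {V : ℝ}
    (hc : ∀ m ∈ Icc 1 n, c m ∈ Ioc (p / q) 1) (hs : Separates p K n c b)
    (hL : ∀ m, m < n → failure D (c (m + 1)) (b m) ≤ V)
    (hR : ∀ m, 1 ≤ m → m < n → failure D (c m) (b m) ≤ V)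
    (hK : failure D (c n) (K (c n)) ≤ V)
    (hlt : (∃ m, m < n ∧ failure D (c (m + 1)) (b m) < V) ∨ failure D (c n) (K (c n)) < V) :
    ∃ d : ℕ → ℝ, (∀ m ∈ Icc 1 n, d m ∈ Ioc (p / q) 1) ∧ StrictAntiOn d (Icc 1 n) ∧
      ∃ v < V, ∀ l ∈ Ico p q, ∃ m ∈ Icc 1 n, failure D (d m) l ≤ v := by
  classical
  -- Even positions of the chain carry points, odd positions ratios. Link 2m joins b m to c (m+1),
  -- link 2m + 1 joins c (m+1) to b (m+1); the last link 2n - 1 uses only c n, and its right-hand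
  -- parameter is a dummy.
  let A : ℕ → ℝ → ℝ → Prop := fun i u v =>
    if Even i then v ∈ Ioc (p / q) 1 ∧ p ≤ u ∧ v * u ≤ p
    else if i + 1 = 2 * n then u ∈ Ioc (p / q) 1
    else u ∈ Ioc (p / q) 1 ∧ p < u * v ∧ v < K u
  let X : ℕ → ℝ → ℝ → ℝ := fun i u v =>
    if Even i then failure D v u else if i + 1 = 2 * n then failure D u (K u) else failure D u v
  let w : ℕ → ℝ := fun i => if Even i then b (i / 2) else c ((i + 1) / 2)
  have E : ∀ m, Even (2 * m) := fun m => even_two_mul m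
  have O : ∀ m, ¬ Even (2 * m + 1) := fun m => by simp [parity_simps]
  have step : ∀ i, i + 1 < 2 * n → ∀ u v t, A i u v → A (i + 1) v t → X i u v ≤ V →
      X (i + 1) v t ≤ V → (X i u v < V ∨ X (i + 1) v t < V) →
      ∃ v', A i u v' ∧ A (i + 1) v' t ∧ X i u v' < V ∧ X (i + 1) v' t < V := by
    intro i hi u v t
    rcases Nat.even_or_odd' i with ⟨m, rfl | rfl⟩
    · by_cases hm : 2 * m + 1 + 1 = 2 * n
      · simp only [A, X, E, O, if_true, if_false, hm]
        rintro ⟨h1, h2, h3⟩ _ h5 h6 h7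
        obtain ⟨x, g1, g2, g3, g4⟩ := F.exists_last_ratio_lt h1 h2 h3 h5 h6 h7
        exact ⟨x, ⟨g1, h2, g2⟩, g1, g3, g4⟩
      · simp only [A, X, E, O, if_true, if_false, hm]
        rintro ⟨h1, h2, h3⟩ ⟨_, h4, h4'⟩ h5 h6 h7
        obtain ⟨x, g1, g2, g3, g4, g5⟩ := F.exists_ratio_lt h1 h2 h3 h4 h4' h5 h6 h7
        exact ⟨x, ⟨g1, h2, g2⟩, ⟨g1, g3⟩, g4, g5⟩
    · have hm : 2 * m + 1 + 1 ≠ 2 * n := by omega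
      have hE : Even (2 * m + 1 + 1) := ⟨m + 1, by ring⟩
      simp only [A, X, hE, O, if_true, if_false, hm]
      rintro ⟨h1, h2, h3⟩ ⟨h4, h5, h6⟩ h7 h8 h9
      obtain ⟨x, g1, g2, g3, g4, g5, g6⟩ := F.exists_point_lt h1 h4 h2 h3 h5 h6 h7 h8 h9
      exact ⟨x, ⟨h1, g1, g2⟩, ⟨h4, g3, g4⟩, g5, g6⟩
  have wE : ∀ m, w (2 * m) = b m := fun m => by simp [w]
  have wO : ∀ m, w (2 * m + 1) = c (m + 1) := fun m => by
    simp only [w, O, if_false]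
    congr 1; omega
  have wE' : ∀ m, w (2 * m + 1 + 1) = b (m + 1) := fun m => wE (m + 1)
  have hA : ∀ i < 2 * n, A i (w i) (w (i + 1)) := by
    intro i hi
    rcases Nat.even_or_odd' i with ⟨m, rfl | rfl⟩
    · simp only [A, E, if_true, wE, wO]
      exact ⟨hc (m + 1) ⟨by omega, by omega⟩, hs.left m (by omega)⟩
    · have := hc (m + 1) ⟨by omega, by omega⟩
      simp only [A, O, if_false, wO, wE']
      split_ifs with h
      · exact this
      · exact ⟨this, hs.right (m + 1) (by omega) (by omega)⟩
  have hX : ∀ i < 2 * n, X i (w i) (w (i + 1)) ≤ V := by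
    intro i hi
    rcases Nat.even_or_odd' i with ⟨m, rfl | rfl⟩
    · simp only [X, E, if_true, wE, wO]
      exact hL m (by omega)
    · simp only [X, O, if_false, wO, wE']
      split_ifs with h
      · obtain rfl : m + 1 = n := by omega
        exact hK
      · exact hR (m + 1) (by omega) (by omega)
  obtain ⟨j, hj, hjV⟩ : ∃ j, j < 2 * n ∧ X j (w j) (w (j + 1)) < V := by
    rcases hlt with ⟨m, hm, h⟩ | h
    · refine ⟨2 * m, by omega, ?_⟩
      simpa only [X, E, if_true, wE, wO] using h
    · obtain ⟨m, rfl⟩ : ∃ m, n = m + 1 := ⟨n - 1, by omega⟩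
      refine ⟨2 * m + 1, by omega, ?_⟩
      have hm : 2 * m + 1 + 1 = 2 * (m + 1) := by ring
      simpa only [X, O, if_false, wO, hm, if_true] using h
  obtain ⟨y, hy0, hy⟩ := exists_chain_lt step w hA hX hj hjV
  have hE : ∀ m, m < n → (y (2 * m + 1) ∈ Ioc (p / q) 1 ∧ p ≤ y (2 * m) ∧
      y (2 * m + 1) * y (2 * m) ≤ p) ∧ failure D (y (2 * m + 1)) (y (2 * m)) < V := by
    intro m hm
    have := hy (2 * m) (by omega)
    simpa only [A, X, E, if_true] using this
  have hO : ∀ m, m + 1 < n → (p < y (2 * m + 1) * y (2 * (m + 1)) ∧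
      y (2 * (m + 1)) < K (y (2 * m + 1))) ∧ failure D (y (2 * m + 1)) (y (2 * (m + 1))) < V := by
    intro m hm
    have := hy (2 * m + 1) (by omega)
    have hm' : 2 * m + 1 + 1 ≠ 2 * n := by omega
    simp only [A, X, O, if_false, hm'] at this
    exact ⟨this.1.2, this.2⟩
  have hLast : failure D (y (2 * n - 1)) (K (y (2 * n - 1))) < V := by
    have := (hy (2 * n - 1) (by omega)).2
    have hm : 2 * n - 1 + 1 = 2 * n := by omega
    have hm' : ¬ Even (2 * n - 1) := by rw [show 2 * n - 1 = 2 * (n - 1) + 1 by omega]; exact O _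
    simpa only [X, hm', if_false, hm, if_true] using this
  let d : ℕ → ℝ := fun m => y (2 * m - 1)
  have hd : ∀ m, d (m + 1) = y (2 * m + 1) := fun m => rfl
  have hdmem : ∀ m ∈ Icc 1 n, d m ∈ Ioc (p / q) 1 := by
    rintro m ⟨h1, h2⟩
    obtain ⟨m, rfl⟩ : ∃ r, m = r + 1 := ⟨m - 1, by omega⟩
    rw [hd]; exact (hE m h2).1.1
  have hsep : Separates p K n d (fun m => y (2 * m)) := by
    refine ⟨by rw [mul_zero, hy0]; exact (wE 0).trans hs.zero, fun m hm => ?_, fun m h1 h2 => ?_⟩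
    · rw [hd]; exact (hE m hm).1.2
    · obtain ⟨m, rfl⟩ : ∃ r, m = r + 1 := ⟨m - 1, by omega⟩
      rw [hd]; exact (hO m h2).1
  refine ⟨d, hdmem, ?_, ?_⟩
  · refine strictAntiOn_of_succ_lt ordConnected_Icc fun m _ h1 h2 => ?_
    have h2' : m + 1 ≤ n := h2.2
    have g1 := (hsep.left m h2').2
    have g2 := (hsep.right m h1.1 h2').1
    exact lt_of_mul_lt_mul_right (g1.trans_lt g2) (F.pos.le.trans (hsep.left m h2').1)
  -- A single v < V is obtained as the maximum of the finitely many link values.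
  · let T : Finset ℝ := insert (failure D (d n) (K (d n)))
      ((Finset.range n).image (fun m => failure D (d (m + 1)) (y (2 * m))) ∪
        ((Finset.range n).filter (1 ≤ ·)).image fun m => failure D (d m) (y (2 * m)))
    have hT : T.Nonempty := ⟨_, Finset.mem_insert_self _ _⟩
    refine ⟨T.max' hT, ?_, fun l hl => F.exists_failure_le hn hdmem hsep ?_ ?_ ?_ hl⟩
    · rw [Finset.max'_lt_iff]
      intro x hx
      simp only [T, Finset.mem_insert, Finset.mem_union, Finset.mem_image, Finset.mem_filter,
        Finset.mem_range] at hx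
      rcases hx with rfl | ⟨m, hm, rfl⟩ | ⟨m, ⟨hm, h1⟩, rfl⟩
      · exact hLast
      · exact (hE m hm).2
      · obtain ⟨m, rfl⟩ : ∃ r, m = r + 1 := ⟨m - 1, by omega⟩
        exact (hO m hm).2
    · intro m hm
      refine Finset.le_max' _ _ ?_
      simp only [T, Finset.mem_insert, Finset.mem_union, Finset.mem_image, Finset.mem_range]
      exact Or.inr (Or.inl ⟨m, hm, rfl⟩)
    · intro m h1 hm
      refine Finset.le_max' _ _ ?_
      simp only [T, Finset.mem_insert, Finset.mem_union, Finset.mem_image, Finset.mem_filter,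
        Finset.mem_range]
      exact Or.inr (Or.inr ⟨m, ⟨hm, h1⟩, rfl⟩)
    · exact Finset.le_max' _ _ (Finset.mem_insert_self _ _)

/-- At a separating point the two neighbouring curves are the lowest. -/
theorem failure_le_at_point (F : PhaseFamily p q D K) {n : ℕ} {c b : ℕ → ℝ}
    (hc : ∀ m ∈ Icc 1 n, c m ∈ Ioc (p / q) 1) (hanti : StrictAntiOn c (Icc 1 n))
    (hs : Separates p K n c b)
    (he : ∀ m, 1 ≤ m → m < n → failure D (c m) (b m) = failure D (c (m + 1)) (b m)) {j m : ℕ}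
    (hj : j < n) (hm : m ∈ Icc 1 n) (hbq : b j < q) :
    failure D (c (j + 1)) (b j) ≤ failure D (c m) (b j) := by
  have hb1 : b j < 1 := hbq.trans_le F.le_one
  have hb0 : 0 < b j := F.pos.trans_le (hs.left j hj).1
  rcases lt_trichotomy m (j + 1) with h | rfl | h
  · have h1 : 1 ≤ j := by have := hm.1; omega
    rw [← he j h1 hj]
    rcases (Nat.lt_succ_iff.1 h).eq_or_lt with rfl | h'
    · exact le_rfl
    · exact (F.failure_lt_right hb0 hb1 (hanti hm ⟨h1, hj.le⟩ h') (hs.right j h1 hj).1.le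
        (by nlinarith [(hc m hm).2])).le
  · exact le_rfl
  · exact (F.failure_lt_left (F.ratio_pos (hc m hm)).le hb0 hb1
      (hanti ⟨by omega, hj⟩ hm h) (hs.left j hj).2).le

/-- All zeros p / c m lie to the left of K (c n), where the smallest ratio fails least. -/
theorem failure_le_at_key (F : PhaseFamily p q D K) {n : ℕ} {c : ℕ → ℝ}
    (hc : ∀ m ∈ Icc 1 n, c m ∈ Ioc (p / q) 1) (hanti : StrictAntiOn c (Icc 1 n)) {m : ℕ}
    (hm : m ∈ Icc 1 n) : failure D (c n) (K (c n)) ≤ failure D (c m) (K (c n)) := by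
  have hn : n ∈ Icc 1 n := ⟨hm.1.trans hm.2, le_rfl⟩
  rcases hm.2.eq_or_lt with rfl | h
  · exact le_rfl
  · have h1 := F.key_gt _ (hc n hn)
    have c0 := F.ratio_pos (hc n hn)
    have hK0 : 0 < K (c n) := by
      by_contra! h0
      nlinarith [F.pos]
    exact (F.failure_lt_right hK0 (F.key_lt_one _ (hc n hn)) (hanti hm hn h) h1.le
      (by nlinarith [(hc m hm).2, F.key_le _ (hc n hn)])).le

end PhaseFamily

/-! ### Verification of the curve properties for `failPoly`. -/

theorem sin_sq_strictMonoOn : StrictMonoOn (fun β => Real.sin β ^ 2) (Icc 0 (Real.pi / 2)) := by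
  intro x hx y hy hxy
  have h := Real.strictMonoOn_sin ⟨by linarith [hx.1, Real.pi_pos], hx.2⟩
    ⟨by linarith [hy.1, Real.pi_pos], hy.2⟩ hxy
  exact pow_lt_pow_left₀ h
    (Real.sin_nonneg_of_nonneg_of_le_pi hx.1 (by linarith [hx.2, Real.pi_pos])) two_ne_zero

theorem exists_sin_sq_eq {B y : ℝ} (hB0 : 0 ≤ B) (hy : y ∈ Icc 0 (Real.sin B ^ 2)) :
    ∃ β ∈ Icc 0 B, Real.sin β ^ 2 = y := by
  have hc : ContinuousOn (fun β => Real.sin β ^ 2) (Icc 0 B) := by fun_prop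
  have := intermediate_value_Icc hB0 hc
  simp only [Real.sin_zero, ne_eq, OfNat.ofNat_ne_zero, not_false_eq_true, zero_pow] at this
  exact this hy

theorem piMax_angle_mem (k : ℕ) : Real.pi / (4 * (k : ℝ) + 2) ∈ Ioc 0 (Real.pi / 2) := by
  have hk : (0 : ℝ) ≤ k := k.cast_nonneg
  refine ⟨by positivity, ?_⟩
  gcongr
  linarith

theorem piMax_pos (k : ℕ) : 0 < piMax k := by
  have h := piMax_angle_mem k
  have : 0 < Real.sin (Real.pi / (4 * (k : ℝ) + 2)) :=
    Real.sin_pos_of_pos_of_lt_pi h.1 (by linarith [h.2, Real.pi_pos])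
  unfold piMax
  positivity

theorem piMax_succ_lt (k : ℕ) : piMax (k + 1) < piMax k := by
  have h0 := piMax_angle_mem k
  have h1 := piMax_angle_mem (k + 1)
  refine sin_sq_strictMonoOn ⟨h1.1.le, h1.2⟩ ⟨h0.1.le, h0.2⟩ ?_
  have hk : (0 : ℝ) ≤ k := k.cast_nonneg
  push_cast
  gcongr
  linarith

theorem piMax_le_one (k : ℕ) : piMax k ≤ 1 := Real.sin_sq_le_one _

theorem piMax_zero : piMax 0 = 1 := by simp [piMax]

theorem piMax_one : piMax 1 = 1 / 4 := by
  have : Real.pi / (4 * ((1 : ℕ) : ℝ) + 2) = Real.pi / 6 := by norm_num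
  rw [piMax, this, Real.sin_pi_div_six]
  norm_num

theorem failPoly_piMax (k : ℕ) (hk : 1 ≤ k) : failPoly k (piMax k) = 0 := by
  have hk' : (1 : ℝ) ≤ k := by exact_mod_cast hk
  have h := cos_mul_failPoly_sin_sq (Real.pi / (4 * (k : ℝ) + 2)) k
  have e : (2 * (k : ℝ) + 1) * (Real.pi / (4 * (k : ℝ) + 2)) = Real.pi / 2 := by field_simp; ring
  rw [e, Real.cos_pi_div_two] at h
  have hB := piMax_angle_mem k
  have hc : 0 < Real.cos (Real.pi / (4 * (k : ℝ) + 2)) := by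
    refine Real.cos_pos_of_mem_Ioo ⟨by linarith [hB.1, Real.pi_pos], ?_⟩
    gcongr
    linarith
  exact (mul_eq_zero.1 h).resolve_left hc.ne'

theorem hasDerivAt_cos_mul_div_cos (N : ℝ) {x : ℝ} (h : Real.cos x ≠ 0) :
    HasDerivAt (fun β => Real.cos (N * β) / Real.cos β)
      ((-(N * Real.sin (N * x)) * Real.cos x + Real.cos (N * x) * Real.sin x) / Real.cos x ^ 2) x := by
  have h1 : HasDerivAt (fun β => Real.cos (N * β)) (-Real.sin (N * x) * (N * 1)) x :=
    ((hasDerivAt_id x).const_mul N).cos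
  exact (h1.div (Real.hasDerivAt_cos x) h).congr_deriv (by ring)

/-- The angle `π / (4 j + 2)` of the right end of the range, in the polynomial of index `j + 1`. -/
theorem mul_piMax_angle_le {j : ℕ} (hj : 1 ≤ j) :
    (2 * ((j + 1 : ℕ) : ℝ) + 1) * (Real.pi / (4 * (j : ℝ) + 2)) ≤ 5 * Real.pi / 6 := by
  have hj' : (1 : ℝ) ≤ j := by exact_mod_cast hj
  push_cast
  rw [mul_div_assoc', div_le_div_iff₀ (by positivity) (by norm_num)]
  nlinarith [Real.pi_pos]

theorem piMax_angle_le {j : ℕ} (hj : 1 ≤ j) : Real.pi / (4 * (j : ℝ) + 2) ≤ Real.pi / 6 := by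
  have hj' : (1 : ℝ) ≤ j := by exact_mod_cast hj
  have := Real.pi_pos
  gcongr
  linarith

theorem piMax_le_quarter {j : ℕ} (hj : 1 ≤ j) : piMax j ≤ 1 / 4 := by
  have h : Real.sin (Real.pi / (4 * (j : ℝ) + 2)) ^ 2 ≤ Real.sin (Real.pi / 6) ^ 2 :=
    sin_sq_strictMonoOn.monotoneOn
      ⟨(piMax_angle_mem j).1.le, (piMax_angle_mem j).2⟩
      ⟨by positivity, by linarith [Real.pi_pos]⟩ (piMax_angle_le hj)
  rw [Real.sin_pi_div_six] at h
  unfold piMax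
  linarith

/-- The numerator of the derivative is -(N - 1) sin(Nx) cos x - sin(Nx - x), and both sines are
positive. -/
theorem strictAntiOn_cos_mul_div_cos {N B : ℝ} (hN : 1 < N) (hB : B < Real.pi / 2)
    (hNB : N * B ≤ Real.pi) :
    StrictAntiOn (fun β => Real.cos (N * β) / Real.cos β) (Icc 0 B) := by
  have hcos : ∀ x ∈ Icc 0 B, 0 < Real.cos x := fun x hx =>
    Real.cos_pos_of_mem_Ioo ⟨by linarith [hx.1, Real.pi_pos], by linarith [hx.2]⟩
  refine strictAntiOn_of_deriv_neg (convex_Icc 0 B)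
    (fun x hx => (hasDerivAt_cos_mul_div_cos N (hcos x hx).ne').continuousAt.continuousWithinAt) ?_
  intro x hx
  rw [interior_Icc] at hx
  have hc := hcos x ⟨hx.1.le, hx.2.le⟩
  rw [(hasDerivAt_cos_mul_div_cos N hc.ne').deriv]
  apply div_neg_of_neg_of_pos _ (by positivity)
  have hNx : N * x < Real.pi := by nlinarith [hx.2]
  have h1 : 0 < Real.sin (N * x) := Real.sin_pos_of_pos_of_lt_pi (by nlinarith [hx.1]) hNx
  have h2 : 0 < Real.sin (N * x - x) :=
    Real.sin_pos_of_pos_of_lt_pi (by nlinarith [hx.1]) (by linarith [hx.1])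
  rw [Real.sin_sub] at h2
  nlinarith [mul_pos (sub_pos.2 hN) (mul_pos h1 hc)]

/-- This is the failure at l = sin² β / c. Since l ≤ 1/4, one has c - s² ≥ 3s²; with sin(Nβ) > 1/2
and N sin β ≥ 1, the growth of D² contributes more than (3/2) s cos β to the bracket in the
derivative, while the factor 1 - l costs at most s cos β. -/
theorem strictMonoOn_failure_angle {N c x₀ x₁ : ℝ} (hN : 0 < N) (hc : 0 < c)
    (h₀ : Real.pi / 2 ≤ N * x₀) (hx : 0 < x₀) (h₁ : N * x₁ ≤ 5 * Real.pi / 6)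
    (h₁' : x₁ < Real.pi / 2) (hq : 4 * Real.sin x₁ ^ 2 ≤ c) :
    StrictMonoOn (fun β => (1 - Real.sin β ^ 2 / c) * (Real.cos (N * β) / Real.cos β) ^ 2)
      (Icc x₀ x₁) := by
  have hpi := Real.pi_pos
  have hcos : ∀ x ∈ Icc x₀ x₁, 0 < Real.cos x := fun x hx' =>
    Real.cos_pos_of_mem_Ioo ⟨by linarith [hx'.1], by linarith [hx'.2]⟩
  have hder : ∀ x ∈ Icc x₀ x₁, HasDerivAt
      (fun β => (1 - Real.sin β ^ 2 / c) * (Real.cos (N * β) / Real.cos β) ^ 2) _ x := fun x hx' =>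
    HasDerivAt.mul ((((Real.hasDerivAt_sin x).pow 2).div_const c).const_sub 1)
      ((hasDerivAt_cos_mul_div_cos N (hcos x hx').ne').pow 2)
  refine strictMonoOn_of_deriv_pos (convex_Icc x₀ x₁)
    (fun x hx' => (hder x hx').continuousAt.continuousWithinAt) ?_
  intro x hx'
  rw [interior_Icc] at hx'
  have hx'' : x ∈ Icc x₀ x₁ := ⟨hx'.1.le, hx'.2.le⟩
  rw [(hder x hx'').deriv]
  have hC := hcos x hx''
  have hNx0 : Real.pi / 2 < N * x := by nlinarith [hx'.1]
  have hNx1 : N * x < 5 * Real.pi / 6 := by nlinarith [hx'.2]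
  have hx0 : 0 < x := hx.trans hx'.1
  have hS : 0 < Real.sin x := Real.sin_pos_of_pos_of_lt_pi hx0 (by linarith [hx'.2])
  have hcN : Real.cos (N * x) < 0 :=
    Real.cos_neg_of_pi_div_two_lt_of_lt hNx0 (by linarith)
  have hsN : 1 / 2 < Real.sin (N * x) := by
    have : Real.sin (Real.pi / 6) < Real.sin (Real.pi - N * x) :=
      Real.sin_lt_sin_of_lt_of_le_pi_div_two (by linarith) (by linarith) (by linarith)
    rwa [Real.sin_pi_sub, Real.sin_pi_div_six] at this
  -- Jordan's inequality sin x ≥ 2x/π, combined with Nx ≥ π/2.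
  have hNS : 1 ≤ N * Real.sin x := by
    have hj := Real.mul_le_sin hx0.le (by linarith [hx'.2] : x ≤ Real.pi / 2)
    have : 1 ≤ N * (2 / Real.pi * x) := by
      rw [show N * (2 / Real.pi * x) = 2 * (N * x) / Real.pi by ring, le_div_iff₀ hpi]
      linarith
    nlinarith
  have hq' : 4 * Real.sin x ^ 2 ≤ c := by
    have : Real.sin x ^ 2 ≤ Real.sin x₁ ^ 2 := sin_sq_strictMonoOn.monotoneOn
      ⟨hx0.le, by linarith [hx'.2]⟩ ⟨by linarith [hx'.2], h₁'.le⟩ hx'.2.le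
    linarith
  have hcos1 := Real.cos_le_one x
  have hcN1 := Real.neg_one_le_cos (N * x)
  generalize Real.sin (N * x) = S at *
  generalize Real.cos (N * x) = E at *
  generalize Real.sin x = s at *
  generalize Real.cos x = C at *
  have hmain : 0 < (c - s ^ 2) * (N * S * C - E * s) + s * C ^ 2 * E := by
    have h1 : 3 * s ^ 2 ≤ c - s ^ 2 := by linarith
    have h2 : 3 / 2 * (s * C) < 3 * s ^ 2 * (N * S * C - E * s) := by
      have a1 : 1 * (1 / 2) < N * s * S := by nlinarith
      have a2 : 0 < s * C := by positivity
      have a3 : 0 < s ^ 3 * (-E) := by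
        have : 0 < -E := by linarith
        positivity
      nlinarith
    have h3 : 0 < N * S * C - E * s := by
      have : 0 < N * S * C := by
        have : 0 < S := by linarith
        positivity
      nlinarith
    have h4 : -(s * C) ≤ s * C ^ 2 * E := by
      have a2 : 0 < s * C := by positivity
      have a4 : -1 ≤ C * E := by nlinarith
      nlinarith
    nlinarith [mul_pos hS hC]
  have key : ∀ r : ℝ, r = 2 * (-E) / (c * C ^ 3) *
      ((c - s ^ 2) * (N * S * C - E * s) + s * C ^ 2 * E) → 0 < r := by
    rintro r rfl
    have : 0 < -E := by linarith
    positivity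
  apply key
  simp only [Nat.add_one_sub_one, pow_one, Nat.cast_ofNat]
  field_simp
  ring

/-- `λ_key` in terms of the phase ratio. -/
noncomputable def keyRatio (k : ℕ) (c : ℝ) : ℝ :=
  if k = 1 then (1 + 8 * c) / (12 * c) else piMax (k - 1)

theorem phaseFamily_one : PhaseFamily (piMax 1) (piMax 0) (failPoly 1) (keyRatio 1) := by
  rw [piMax_one, piMax_zero]
  have hmem : ∀ c ∈ Ioc ((1 / 4 : ℝ) / 1) 1, 1 / 4 < c := fun c hc => by simpa using hc.1
  have hK : ∀ c, keyRatio 1 c = (1 + 8 * c) / (12 * c) := fun c => by simp [keyRatio]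
  -- With u = 4cl - 1 and a = 4c - 1 the failure is a positive multiple of a u² - u³, whose maximum
  -- over u ≥ 0 is at u = 2a/3; this is `keyRatio 1`.
  have hcub : ∀ c l : ℝ, 4 * c * failure (failPoly 1) c l =
      (4 * c - 1) * (4 * (c * l) - 1) ^ 2 - (4 * (c * l) - 1) ^ 3 := by
    intro c l; simp only [failure, failPoly]; ring
  refine ⟨by norm_num, by norm_num, le_rfl, continuous_failPoly 1, ?_, by norm_num [failPoly],
    ?_, ?_, ?_, ?_, ?_, ?_, ?_⟩
  · intro x _ y _ h
    simp only [failPoly]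
    linarith
  · intro c hc
    have := hmem c hc
    rw [hK, mul_div_assoc', lt_div_iff₀ (by linarith)]
    nlinarith
  · intro c hc
    have := hmem c hc
    rw [hK, div_le_one (by linarith)]
    linarith
  · intro c hc
    have := hmem c hc
    rw [hK, div_lt_one (by linarith)]
    linarith
  · intro c hc
    have := hmem c hc
    have e : keyRatio 1 = fun c => (1 + 8 * c) / (12 * c) := funext hK
    rw [e]
    exact ContinuousAt.div (by fun_prop) (by fun_prop) (by linarith)
  · intro c hc l l' h1 h2 h3
    have h0 := hmem c hc
    rw [hK, le_div_iff₀ (by linarith)] at h3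
    have hlt : c * l < c * l' := by
      have : 0 < c := by linarith
      gcongr
    refine lt_of_mul_lt_mul_left (a := 4 * c) ?_ (by linarith)
    rw [hcub, hcub]
    have hu : 0 ≤ 4 * (c * l) - 1 := by linarith
    have huv : 4 * (c * l) - 1 < 4 * (c * l') - 1 := by linarith
    have hv : 3 * (4 * (c * l') - 1) ≤ 2 * (4 * c - 1) := by linarith
    generalize 4 * (c * l) - 1 = u at *
    generalize 4 * (c * l') - 1 = v at *
    generalize 4 * c - 1 = a at *
    have : 0 < (v - u) * (a * (u + v) - (u ^ 2 + u * v + v ^ 2)) := by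
      apply mul_pos (by linarith)
      nlinarith
    nlinarith
  · intro c hc l h1 h2
    have h0 := hmem c hc
    refine le_of_mul_le_mul_left (a := 4 * c) ?_ (by linarith)
    have hk : 4 * (c * keyRatio 1 c) - 1 = 2 / 3 * (4 * c - 1) := by
      rw [hK]; field_simp; ring
    rw [hcub, hcub, hk]
    have hu : 0 ≤ 4 * (c * l) - 1 := by linarith
    have ha : 0 ≤ 4 * c - 1 := by linarith
    generalize 4 * (c * l) - 1 = u at *
    generalize 4 * c - 1 = a at *
    -- The gap to the maximum factors as (u - 2a/3)² (u + a/3).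
    nlinarith [mul_nonneg (sq_nonneg (u - 2 / 3 * a)) (by linarith : 0 ≤ u + a / 3)]
  · intro c hc c' hc' h l hl0 hl1 he
    have h0 := hmem c hc
    have h0' := hmem c' hc'
    simp only [failPoly] at he
    rw [hK, lt_div_iff₀ (by linarith)]
    -- The crossing is l = 1/(2(c + c')) < 2/(4c + 1), as c' > 1/4; that this bound is at most K c
    -- amounts to (4c - 1)(8c - 1) ≥ 0.
    have e1 : l * (4 * c + 1) < 2 := by nlinarith
    have : 0 ≤ (4 * c - 1) * (8 * c - 1) := mul_nonneg (by linarith) (by linarith)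
    refine lt_of_mul_lt_mul_right (a := 4 * c + 1) ?_ (by linarith)
    nlinarith

theorem phaseFamily_succ {j : ℕ} (hj : 1 ≤ j) :
    PhaseFamily (piMax (j + 1)) (piMax j) (failPoly (j + 1)) (keyRatio (j + 1)) := by
  have hK : ∀ c, keyRatio (j + 1) c = piMax j := fun c => by
    rw [keyRatio, if_neg (by omega), Nat.add_sub_cancel]
  have hpos := piMax_pos (j + 1)
  have hqpos := piMax_pos j
  have hq4 := piMax_le_quarter hj
  have hpi := Real.pi_pos
  have hB := piMax_angle_mem j
  have hB6 := piMax_angle_le hj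
  have hNB := mul_piMax_angle_le hj
  have hN : (1 : ℝ) < 2 * ((j + 1 : ℕ) : ℝ) + 1 := by
    have : (0 : ℝ) ≤ j := j.cast_nonneg
    push_cast; linarith
  have hcos : ∀ x ∈ Icc 0 (Real.pi / (4 * (j : ℝ) + 2)), 0 < Real.cos x := fun x hx =>
    Real.cos_pos_of_mem_Ioo ⟨by linarith [hx.1], by linarith [hx.2]⟩
  have hang : ∀ {β β'}, β ∈ Icc 0 (Real.pi / (4 * (j : ℝ) + 2)) →
      β' ∈ Icc 0 (Real.pi / (4 * (j : ℝ) + 2)) →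
      (Real.sin β ^ 2 < Real.sin β' ^ 2 ↔ β < β') := fun h h' =>
    sin_sq_strictMonoOn.lt_iff_lt ⟨h.1, h.2.trans hB.2⟩ ⟨h'.1, h'.2.trans hB.2⟩
  have hmono : ∀ c ∈ Ioc (piMax (j + 1) / piMax j) 1, ∀ l l', piMax (j + 1) ≤ c * l → l < l' →
      l' ≤ piMax j → failure (failPoly (j + 1)) c l < failure (failPoly (j + 1)) c l' := by
    intro c hc l l' h1 h2 h3
    have c0 : 0 < c := (div_pos hpos hqpos).trans hc.1
    have hlt : c * l < c * l' := by gcongr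
    have hl' : 0 < l' := by
      by_contra! h0
      nlinarith
    obtain ⟨β, hβ, e⟩ := exists_sin_sq_eq (y := c * l) hB.1.le
      ⟨by linarith, by show _ ≤ piMax j; nlinarith [hc.2]⟩
    obtain ⟨β', hβ', e'⟩ := exists_sin_sq_eq (y := c * l') hB.1.le
      ⟨by linarith, by show _ ≤ piMax j; nlinarith [hc.2]⟩
    have hββ : β < β' := (hang hβ hβ').1 (by rw [e, e']; exact hlt)
    have hβ0 : Real.pi / (4 * ((j + 1 : ℕ) : ℝ) + 2) ≤ β := by
      have hx := piMax_angle_mem (j + 1)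
      refine (sin_sq_strictMonoOn.le_iff_le ⟨hx.1.le, hx.2⟩ ⟨hβ.1, hβ.2.trans hB.2⟩).1 ?_
      show piMax (j + 1) ≤ Real.sin β ^ 2
      rw [e]; exact h1
    have hβpos : 0 < β := (piMax_angle_mem (j + 1)).1.trans_le hβ0
    have hN0 : Real.pi / 2 ≤ (2 * ((j + 1 : ℕ) : ℝ) + 1) * β := by
      rw [div_le_iff₀ (by positivity)] at hβ0
      linarith
    -- The condition 4 sin² β' ≤ c is l' ≤ 1/4, which holds because q ≤ 1/4 for j ≥ 1.
    have := strictMonoOn_failure_angle (by linarith) c0 hN0 hβpos (x₁ := β')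
      ((mul_le_mul_of_nonneg_left hβ'.2 (by linarith)).trans hNB) (by linarith [hβ'.2])
      (by rw [e']; nlinarith) ⟨le_rfl, hββ.le⟩ ⟨hββ.le, le_rfl⟩ hββ
    simp only at this
    rw [← failPoly_sin_sq _ (hcos β hβ).ne', ← failPoly_sin_sq _ (hcos β' hβ').ne', e, e',
      mul_div_cancel_left₀ _ c0.ne', mul_div_cancel_left₀ _ c0.ne'] at this
    exact this
  refine ⟨hpos, piMax_succ_lt j, piMax_le_one j, continuous_failPoly _, ?_,
    failPoly_piMax (j + 1) (by omega), ?_, ?_, ?_, ?_, ?_, ?_, ?_⟩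
  · intro x hx y hy hxy
    obtain ⟨β, hβ, rfl⟩ := exists_sin_sq_eq hB.1.le hx
    obtain ⟨β', hβ', rfl⟩ := exists_sin_sq_eq hB.1.le hy
    rw [failPoly_sin_sq _ (hcos β hβ).ne', failPoly_sin_sq _ (hcos β' hβ').ne']
    exact strictAntiOn_cos_mul_div_cos hN (by linarith) (by linarith) hβ hβ' ((hang hβ hβ').1 hxy)
  · intro c hc
    rw [hK, ← div_lt_iff₀ hqpos]
    exact hc.1
  · intro c _
    rw [hK]
  · intro c _
    rw [hK]; linarith
  · intro c _
    rw [show keyRatio (j + 1) = fun _ => piMax j from funext hK]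
    exact continuousAt_const
  · intro c hc l l' h1 h2 h3
    rw [hK] at h3
    exact hmono c hc l l' h1 h2 h3
  · intro c hc l h1 h2
    rw [hK]
    rcases h2.eq_or_lt with rfl | h2
    · exact le_rfl
    · exact (hmono c hc l _ h1 h2 le_rfl).le
  · intro c _ c' _ _ l _ hl _
    rwa [hK]

theorem phaseFamily {k : ℕ} (hk : 1 ≤ k) :
    PhaseFamily (piMax k) (piMax (k - 1)) (failPoly k) (keyRatio k) := by
  obtain ⟨j, rfl⟩ : ∃ j, k = j + 1 := ⟨k - 1, by omega⟩
  rcases Nat.eq_zero_or_pos j with rfl | hj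
  · exact phaseFamily_one
  · exact phaseFamily_succ hj

/-! ### Translation between phases and ratios. -/

theorem cos_phaseMin {k : ℕ} (hk : 1 ≤ k) :
    Real.cos (phaseMin k) = 1 - 2 * (piMax k / piMax (k - 1)) := by
  have F := phaseFamily hk
  have hq := F.pos.trans F.lt
  have h1 : ∀ x : ℝ, 1 - Real.cos (2 * x) = 2 * Real.sin x ^ 2 := by
    intro x; rw [Real.cos_two_mul, Real.sin_sq]; ring
  have hk' : (1 : ℝ) ≤ k := by exact_mod_cast hk
  have e1 : 1 - Real.cos (Real.pi / (2 * (k : ℝ) + 1)) = 2 * piMax k := by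
    rw [piMax, ← h1]
    congr 2
    field_simp
    ring
  have e2 : 1 - Real.cos (Real.pi / (2 * (k : ℝ) - 1)) = 2 * piMax (k - 1) := by
    rw [piMax, ← h1]
    congr 2
    push_cast [Nat.cast_sub hk]
    have h2 : 2 * (k : ℝ) - 1 ≠ 0 := by linarith
    have h3 : 4 * ((k : ℝ) - 1) + 2 ≠ 0 := by linarith
    field_simp
    ring
  have e3 : (2 - 2 * Real.cos (Real.pi / (2 * (k : ℝ) + 1))) /
      (1 - Real.cos (Real.pi / (2 * (k : ℝ) - 1))) = 2 * (piMax k / piMax (k - 1)) := by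
    rw [e2, show 2 - 2 * Real.cos (Real.pi / (2 * (k : ℝ) + 1)) = 2 * (2 * piMax k) by
      rw [← e1]; ring]
    field_simp
  have h0 : 0 < piMax k / piMax (k - 1) := div_pos F.pos hq
  have h2 : piMax k / piMax (k - 1) < 1 := (div_lt_one hq).2 F.lt
  rw [phaseMin, e3, Real.cos_arccos (by linarith) (by linarith)]

theorem phaseMin_nonneg (k : ℕ) : 0 ≤ phaseMin k := Real.arccos_nonneg _

theorem phaseRatio_strictMonoOn : StrictMonoOn phaseRatio (Icc 0 Real.pi) := by
  intro x hx y hy h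
  have := Real.strictAntiOn_cos hx hy h
  unfold phaseRatio
  linarith

theorem phaseRatio_phaseMin {k : ℕ} (hk : 1 ≤ k) :
    phaseRatio (phaseMin k) = piMax k / piMax (k - 1) := by
  rw [phaseRatio, cos_phaseMin hk]; ring

theorem phaseRatio_mem_iff {k : ℕ} (hk : 1 ≤ k) {φ : ℝ} (hφ : φ ∈ Icc 0 Real.pi) :
    phaseRatio φ ∈ Ioc (piMax k / piMax (k - 1)) 1 ↔ φ ∈ Ioc (phaseMin k) Real.pi := by
  have h : piMax k / piMax (k - 1) < phaseRatio φ ↔ phaseMin k < φ := by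
    rw [← phaseRatio_phaseMin hk]
    exact phaseRatio_strictMonoOn.lt_iff_lt ⟨phaseMin_nonneg k, Real.arccos_le_pi _⟩ hφ
  have h1 : phaseRatio φ ≤ 1 := by
    unfold phaseRatio
    linarith [Real.neg_one_le_cos φ]
  simp only [mem_Ioc, h, h1, hφ.2]

theorem admissiblePhases_iff {k n : ℕ} (hk : 1 ≤ k) {φ : ℕ → ℝ}
    (hφ : ∀ m ∈ Icc 1 n, φ m ∈ Icc 0 Real.pi) :
    AdmissiblePhases k n φ ↔
      (∀ m ∈ Icc 1 n, phaseRatio (φ m) ∈ Ioc (piMax k / piMax (k - 1)) 1) ∧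
        StrictAntiOn (fun m => phaseRatio (φ m)) (Icc 1 n) := by
  refine and_congr (forall₂_congr fun m hm => (phaseRatio_mem_iff hk (hφ m hm)).symm) ?_
  exact forall₅_congr fun i hi j hj _ =>
    (phaseRatio_strictMonoOn.lt_iff_lt (hφ _ hj) (hφ _ hi)).symm

theorem AdmissiblePhases.mem_Icc {k n : ℕ} {φ : ℕ → ℝ} (h : AdmissiblePhases k n φ) :
    ∀ m ∈ Icc 1 n, φ m ∈ Icc 0 Real.pi := fun m hm =>
  ⟨(phaseMin_nonneg k).trans (h.1 m hm).1.le, (h.1 m hm).2⟩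

theorem phaseRatio_arccos {c : ℝ} (h0 : 0 ≤ c) (h1 : c ≤ 1) :
    phaseRatio (Real.arccos (1 - 2 * c)) = c := by
  rw [phaseRatio, Real.cos_arccos (by linarith) (by linarith)]; ring

theorem lamKey_eq (k : ℕ) (φ : ℝ) : lamKey k φ = keyRatio k (phaseRatio φ) := by
  unfold lamKey keyRatio phaseRatio
  split_ifs
  · congr 1 <;> ring
  · rfl

theorem successProb_eq_failure (k : ℕ) (φ : ℝ) {l : ℝ} (h : l ∈ Icc (0 : ℝ) 1) :
    successProb k φ l = 1 - failure (failPoly k) (phaseRatio φ) l :=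
  successProb_eq k φ h

theorem range_subset {k : ℕ} (hk : 1 ≤ k) : range k ⊆ Icc 0 1 := fun _ hl =>
  ⟨(phaseFamily hk).pos.le.trans hl.1, hl.2.le.trans (phaseFamily hk).le_one⟩

/-! ### Minimum success probability in terms of failure bounds. -/

theorem bddBelow_successProb {k n : ℕ} (φ : ℕ → ℝ) (s : Subdivision k n) :
    BddBelow (Set.range fun l : range k => successProb k (φ (s.1 l)) l) :=
  ⟨0, by rintro _ ⟨l, rfl⟩; exact Complex.normSq_nonneg _⟩

theorem nonempty_range {k : ℕ} (hk : 1 ≤ k) : Nonempty (range k) :=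
  ⟨⟨piMax k, le_rfl, (phaseFamily hk).lt⟩⟩

theorem minSuccessOn_le_one {k n : ℕ} (hk : 1 ≤ k) (φ : ℕ → ℝ) (s : Subdivision k n) :
    minSuccessOn k n φ s ≤ 1 := by
  obtain ⟨l⟩ := nonempty_range hk
  refine (ciInf_le (bddBelow_successProb φ s) l).trans ?_
  rw [successProb_eq_failure k _ (range_subset hk l.2)]
  linarith [PhaseFamily.failure_nonneg (D := failPoly k) (c := phaseRatio (φ (s.1 l)))
    (range_subset hk l.2).2]

theorem le_minSuccess {k n : ℕ} (hk : 1 ≤ k) {φ : ℕ → ℝ} {v : ℝ}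
    (h : ∀ l ∈ range k, ∃ m ∈ Icc 1 n, failure (failPoly k) (phaseRatio (φ m)) l ≤ v) :
    1 - v ≤ minSuccess k n φ := by
  have := nonempty_range hk
  choose! s hs hsv using h
  have hbdd : BddAbove (Set.range fun s : Subdivision k n => minSuccessOn k n φ s) :=
    ⟨1, by rintro _ ⟨s, rfl⟩; exact minSuccessOn_le_one hk φ s⟩
  refine le_trans ?_ (le_ciSup hbdd ⟨fun l => s l, fun l => hs l l.2⟩)
  refine le_ciInf fun l => ?_
  rw [successProb_eq_failure k _ (range_subset hk l.2)]
  have := hsv l l.2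
  dsimp only
  linarith

/-- A minimum success probability above `1 - e` comes with a uniform bound below `e` on the failure,
also at the right end point of the range. -/
theorem exists_failure_le_of_lt_minSuccess {k n : ℕ} (hk : 1 ≤ k) (hn : 1 ≤ n) {φ : ℕ → ℝ} {e : ℝ}
    (h : 1 - e < minSuccess k n φ) :
    ∃ v < e, ∀ l ∈ Icc (piMax k) (piMax (k - 1)), ∃ m ∈ Icc 1 n,
      failure (failPoly k) (phaseRatio (φ m)) l ≤ v := by
  have F := phaseFamily hk
  have : Nonempty (Subdivision k n) := ⟨⟨fun _ => 1, fun _ => ⟨le_rfl, hn⟩⟩⟩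
  obtain ⟨s, hs⟩ := exists_lt_of_lt_ciSup h
  have hIco : ∀ l ∈ range k, ∃ m ∈ Icc 1 n,
      failure (failPoly k) (phaseRatio (φ m)) l ≤ 1 - minSuccessOn k n φ s := by
    intro l hl
    refine ⟨s.1 ⟨l, hl⟩, s.2 ⟨l, hl⟩, ?_⟩
    have h1 : minSuccessOn k n φ s ≤ successProb k (φ (s.1 ⟨l, hl⟩)) l :=
      ciInf_le (bddBelow_successProb φ s) ⟨l, hl⟩
    rw [successProb_eq_failure k _ (range_subset hk hl)] at h1
    linarith
  refine ⟨1 - minSuccessOn k n φ s, by linarith, fun l hl => ?_⟩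
  rcases hl.2.eq_or_lt with rfl | hlt
  -- The end point q is not in the range, but is λ_key for k ≥ 2. If all of the finitely many curves
  -- exceeded the bound there, by continuity they would do so just before q.
  · by_contra! hcon
    have hev : ∀ᶠ x in 𝓝[<] (piMax (k - 1)), ∀ m ∈ Icc 1 n,
        1 - minSuccessOn k n φ s < failure (failPoly k) (phaseRatio (φ m)) x := by
      refine Filter.Eventually.filter_mono nhdsWithin_le_nhds ?_
      rw [Filter.eventually_all_finite (finite_Icc 1 n)]
      intro m hm
      exact continuousAt_const.eventually_lt
        (F.continuous_failure continuous_const continuous_id).continuousAt (hcon m hm)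
    obtain ⟨x, hx, hx'⟩ := (hev.and (Ico_mem_nhdsLT F.lt)).exists
    obtain ⟨m, hm, hle⟩ := hIco x hx'
    exact absurd hle (not_le.2 (hx m hm))
  · exact hIco l ⟨hl.1, hlt⟩

end MultiphaseSearch

/-! ### The optimality criterion. -/

theorem theorem1 (k n : ℕ) (hk : 1 ≤ k) (hn : 1 ≤ n) (φ : ℕ → ℝ)
    (hφ : MultiphaseSearch.AdmissiblePhases k n φ) :
    (∀ m, 1 ≤ m → m < n → ∃! x, MultiphaseSearch.IsCrossing k (φ m) (φ (m + 1)) x) ∧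
    ∀ a : ℕ → ℝ, MultiphaseSearch.IsDivision k n φ a →
      (MultiphaseSearch.OptimalPhases k n φ ↔
        ∀ m ∈ Set.Icc 1 n,
          MultiphaseSearch.successProb k (φ m) (a (m - 1)) =
            MultiphaseSearch.successProb k (φ n) (MultiphaseSearch.lamKey k (φ n))) := by
  open MultiphaseSearch in
  have F := phaseFamily hk
  obtain ⟨hc, hanti⟩ := (admissiblePhases_iff hk hφ.mem_Icc).1 hφ
  have hcross : ∀ ψ ψ' x, IsCrossing k ψ ψ' x ↔ x ∈ Set.Ico (piMax k) (piMax (k - 1)) ∧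
      failure (failPoly k) (phaseRatio ψ) x = failure (failPoly k) (phaseRatio ψ') x := by
    intro ψ ψ' x
    refine and_congr_right fun hx => ?_
    rw [successProb_eq_failure k _ (range_subset hk hx),
      successProb_eq_failure k _ (range_subset hk hx), sub_right_inj]
  refine ⟨fun m h1 h2 => ?_, fun a ha => ?_⟩
  · simp only [hcross]
    exact F.existsUnique_crossing (hc m ⟨h1, h2.le⟩) (hc (m + 1) ⟨by omega, h2⟩)
      (hanti ⟨h1, h2.le⟩ ⟨by omega, h2⟩ (by omega))
  obtain ⟨ha0, -, ham⟩ := ha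
  simp only [hcross] at ham
  have hs : Separates (piMax k) (keyRatio k) n (fun m => phaseRatio (φ m)) a :=
    F.separates hc hanti ha0 ham
  have haI : ∀ m, m < n → a m ∈ Set.Ico (piMax k) (piMax (k - 1)) := by
    intro m hm
    rcases Nat.eq_zero_or_pos m with rfl | h
    · rw [ha0]; exact ⟨le_rfl, F.lt⟩
    · exact (ham m h hm).1
  have hcn := hc n ⟨hn, le_rfl⟩
  have hKp : piMax k ≤ keyRatio k (phaseRatio (φ n)) := by
    have h1 := F.key_gt _ hcn
    have h2 := F.ratio_pos hcn
    by_contra! h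
    nlinarith [F.pos, hcn.2]
  have hiff : (∀ m ∈ Set.Icc 1 n, successProb k (φ m) (a (m - 1)) =
      successProb k (φ n) (lamKey k (φ n))) ↔ ∀ m, m < n →
        failure (failPoly k) (phaseRatio (φ (m + 1))) (a m) =
          failure (failPoly k) (phaseRatio (φ n)) (keyRatio k (phaseRatio (φ n))) := by
    have key : ∀ m, m < n → (successProb k (φ (m + 1)) (a m) =
        successProb k (φ n) (lamKey k (φ n)) ↔
        failure (failPoly k) (phaseRatio (φ (m + 1))) (a m) =
          failure (failPoly k) (phaseRatio (φ n)) (keyRatio k (phaseRatio (φ n)))) := by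
      intro m hm
      rw [lamKey_eq, successProb_eq_failure k _ (range_subset hk (haI m hm)),
        successProb_eq_failure k _ ⟨F.pos.le.trans hKp, (F.key_lt_one _ hcn).le⟩, sub_right_inj]
    constructor
    · intro h m hm
      exact (key m hm).1 (h (m + 1) ⟨by omega, hm⟩)
    · rintro h m ⟨h1, h2⟩
      obtain ⟨m, rfl⟩ : ∃ r, m = r + 1 := ⟨m - 1, by omega⟩
      exact (key m h2).2 (h m h2)
  rw [hiff]
  constructor
  · rintro ⟨-, hopt⟩
    by_contra! hne
    obtain ⟨i, hi, hne⟩ := hne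
    -- the largest value at the separating points and at the last maximum
    obtain ⟨V, hVL, hVK, hVatt⟩ : ∃ V, (∀ m, m < n →
        failure (failPoly k) (phaseRatio (φ (m + 1))) (a m) ≤ V) ∧
        failure (failPoly k) (phaseRatio (φ n)) (keyRatio k (phaseRatio (φ n))) ≤ V ∧
        ((∃ m, m < n ∧ failure (failPoly k) (phaseRatio (φ (m + 1))) (a m) = V) ∨
          failure (failPoly k) (phaseRatio (φ n)) (keyRatio k (phaseRatio (φ n))) = V) := by
      obtain ⟨m, hm, hmax⟩ := (Finset.range n).exists_max_image
        (fun m => failure (failPoly k) (phaseRatio (φ (m + 1))) (a m)) ⟨i, Finset.mem_range.2 hi⟩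
      simp only [Finset.mem_range] at hm hmax
      refine ⟨max _ _, fun r hr => (hmax r hr).trans (le_max_left _ _), le_max_right _ _, ?_⟩
      rcases max_choice (failure (failPoly k) (phaseRatio (φ (m + 1))) (a m))
        (failure (failPoly k) (phaseRatio (φ n)) (keyRatio k (phaseRatio (φ n)))) with h | h
      · exact Or.inl ⟨m, hm, h.symm⟩
      · exact Or.inr h.symm
    have hlt : (∃ m, m < n ∧ failure (failPoly k) (phaseRatio (φ (m + 1))) (a m) < V) ∨
        failure (failPoly k) (phaseRatio (φ n)) (keyRatio k (phaseRatio (φ n))) < V := by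
      by_contra! h
      exact hne ((le_antisymm (hVL i hi) (h.1 i hi)).trans (le_antisymm hVK h.2).symm)
    obtain ⟨d, hd, hdanti, v, hvV, hv⟩ := F.exists_better hn hc hs hVL
      (fun m h1 h2 => (ham m h1 h2).2.trans_le (hVL m h2)) hVK hlt
    have hrat : ∀ m ∈ Set.Icc 1 n, phaseRatio (Real.arccos (1 - 2 * d m)) = d m := fun m hm =>
      phaseRatio_arccos (F.ratio_pos (hd m hm)).le (hd m hm).2
    have hadm : AdmissiblePhases k n fun m => Real.arccos (1 - 2 * d m) := by
      refine (admissiblePhases_iff hk fun m _ =>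
        ⟨Real.arccos_nonneg _, Real.arccos_le_pi _⟩).2 ⟨fun m hm => ?_, fun x hx y hy h => ?_⟩
      · rw [hrat m hm]; exact hd m hm
      · simp only [hrat x hx, hrat y hy]; exact hdanti hx hy h
    have hge : 1 - v ≤ minSuccess k n fun m => Real.arccos (1 - 2 * d m) := by
      refine le_minSuccess hk fun l hl => ?_
      obtain ⟨m, hm, h⟩ := hv l hl
      exact ⟨m, hm, by rwa [hrat m hm]⟩
    -- Optimality transfers the improvement to φ itself: at every point some curve of φ fails with
    -- probability below V. Where V is attained, no curve of φ goes below V.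
    obtain ⟨v', hv'V, hv'⟩ := exists_failure_le_of_lt_minSuccess hk hn (φ := φ) (e := V)
      (by linarith [hopt _ hadm])
    rcases hVatt with ⟨j, hj, hjV⟩ | hjV
    · obtain ⟨m, hm, h⟩ := hv' (a j) ⟨(haI j hj).1, (haI j hj).2.le⟩
      have := F.failure_le_at_point hc hanti hs (fun m h1 h2 => (ham m h1 h2).2) hj hm (haI j hj).2
      linarith
    · obtain ⟨m, hm, h⟩ := hv' _ ⟨hKp, F.key_le _ hcn⟩
      have := F.failure_le_at_key hc hanti hm
      linarith
  · intro heq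
    refine ⟨hφ, fun ψ hψ => ?_⟩
    obtain ⟨hψc, -⟩ := (admissiblePhases_iff hk hψ.mem_Icc).1 hψ
    have hR : ∀ m, 1 ≤ m → m < n → failure (failPoly k) (phaseRatio (φ m)) (a m) =
        failure (failPoly k) (phaseRatio (φ n)) (keyRatio k (phaseRatio (φ n))) :=
      fun m h1 h2 => (ham m h1 h2).2.trans (heq m h2)
    have hge := le_minSuccess hk fun l hl => F.exists_failure_le hn hc hs
      (fun m hm => (heq m hm).le) (fun m h1 h2 => (hR m h1 h2).le) le_rfl hl
    by_contra! hlt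
    obtain ⟨v, hv, hv'⟩ := exists_failure_le_of_lt_minSuccess hk hn (hge.trans_lt hlt)
    exact absurd (F.le_of_equalized hn hc hs heq hR rfl hψc hv') (not_le.2 hv)
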